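/- For a compact topological group $G$, let $\widehat G$ be the set of equivalence classes of irreducible (continuous) unitary representations of $G$, and define the Witten $L$-function of $g\in G$ by $$\zeta^W_G(s,g)=\sum_{\rho\in\widehat G}\frac{\operatorname{trace}(\rho(g))}{\deg(\rho)}\,\deg(\rho)^{-s}.$$ Suppose $g\in SU(2)$ is conjugate to $\begin{pmatrix}e^{i\theta}&0\\0&e^{-i\theta}\end{pmatrix}$ with $0\le\theta\le\pi$. (1) For $\operatorname{Re}(s)>1$ the defining series converges absolutely, and $$\zeta^W_{SU(2)}(s,g)=\sum_{n=1}^\infty\frac{\sin(n\theta)}{n\sin\theta}\,n^{-s},$$ where $\frac{\sin(n\theta)}{n\sin\theta}$ is interpreted as $1$ if $\theta=0$ and as $(-1)^{n-1}$ if $\theta=\pi$. The function $s\mapsto\zeta^W_{SU(2)}(s,g)$ has a meromorphic continuation to the whole complex plane, denoted by the same symbol. (2) For every positive even integer $m$, the continuation is holomorphic at $s=-m$ and $\zeta^W_{SU(2)}(-m,g)=0$ for all $g\in SU(2)$. Moreover, $s=-2$ is a simple zero of $\zeta^W_{SU(2)}(s,g)$, and $$\frac{\partial\zeta^W_{SU(2)}}{\partial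 s}(-2,g)=\begin{cases}-\dfrac{\zeta(3)}{4\pi^2}&\text{if }\theta=0,\\[2mm]\dfrac1{4\pi\sin\theta}\left(\zeta\!\left(2,\dfrac{\theta}{2\pi}\right)-\dfrac{\pi^2}{2\sin^2\frac\theta2}\right)>0&\text{if }0<\theta<\pi,\\[2mm]\dfrac{7\zeta(3)}{4\pi^2}&\text{if }\theta=\pi.\end{cases}$$ Here $\zeta(s)$ is the Riemann zeta function and $\zeta(s,x)$ is the Hurwitz zeta function, the meromorphic continuation of $\sum_{n\ge0}(n+x)^{-s}$. (3) The continuation is holomorphic at $s=-1$, and $$\zeta^W_{SU(2)}(-1,g)=\begin{cases}-\dfrac1{12}&\text{if }\theta=0,\\[2mm]\dfrac1{4\sin^2\frac\theta2}&\text{if }0<\theta<\pi,\\[2mm]\dfrac14&\text{if }\theta=\pi.\end{cases}$$ -/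

import Mathlib

open Complex

noncomputable section

/-- A (finite-dimensional) continuous irreducible unitary representation of the topological group
`G`, realised on the Hermitian space `ℂ ^ dim`.  For compact `G` every irreducible unitary
representation is finite-dimensional, hence isomorphic to one of these. -/
structure IrredUnitaryRep (G : Type*) [Group G] [TopologicalSpace G] where
  /-- the degree of the representation -/
  dim : ℕ
  /-- the representation, as a homomorphism to the unitary group -/
  hom : G →* Matrix.unitaryGroup (Fin dim) ℂ
  continuous_hom : Continuous hom
  /-- irreducible: nonzero, and without proper nonzero invariant subspaces -/
  irreducible : Representation.IsIrreducible
    (((Matrix.toLinAlgEquiv' : Matrix (Fin dim) (Fin dim) ℂ ≃ₐ[ℂ] _) : _ →* _).comp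
        ((Matrix.unitaryGroup (Fin dim) ℂ).subtype.comp hom) :
      Representation ℂ G (Fin dim → ℂ))

namespace IrredUnitaryRep

variable {G : Type*} [Group G] [TopologicalSpace G]

/-- The underlying linear representation on `ℂ ^ dim`. -/
def rep (ρ : IrredUnitaryRep G) : Representation ℂ G (Fin ρ.dim → ℂ) :=
  ((Matrix.toLinAlgEquiv' : Matrix (Fin ρ.dim) (Fin ρ.dim) ℂ ≃ₐ[ℂ] _) : _ →* _).comp
    ((Matrix.unitaryGroup (Fin ρ.dim) ℂ).subtype.comp ρ.hom)

/-- Equivalence of representations: existence of an invertible intertwining operator. -/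
instance setoid (G : Type*) [Group G] [TopologicalSpace G] : Setoid (IrredUnitaryRep G) where
  r ρ σ := Nonempty (ρ.rep.Equiv σ.rep)
  iseqv :=
    { refl := fun ρ => ⟨Representation.Equiv.refl ρ.rep⟩
      symm := fun ⟨φ⟩ => ⟨φ.symm⟩
      trans := fun ⟨φ⟩ ⟨ψ⟩ => ⟨φ.trans ψ⟩ }

end IrredUnitaryRep

/-- The unitary dual of `G`: the set of equivalence classes of irreducible unitary
representations. -/
def UnitaryDual (G : Type*) [Group G] [TopologicalSpace G] :=
  Quotient (IrredUnitaryRep.setoid G)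

namespace UnitaryDual

variable {G : Type*} [Group G] [TopologicalSpace G]

/-- The degree of a class in the unitary dual. -/
def deg : UnitaryDual G → ℕ :=
  Quotient.lift IrredUnitaryRep.dim (by
    rintro ρ σ ⟨φ⟩
    simpa using φ.toLinearEquiv.finrank_eq)

/-- The trace of `ρ(g)` for a class `ρ` in the unitary dual. -/
def trace (g : G) : UnitaryDual G → ℂ :=
  Quotient.lift (fun ρ => ρ.rep.character g) (by
    rintro ρ σ ⟨φ⟩
    exact congrFun (Representation.char_iso φ) g)

end UnitaryDual

/-- The term of the class `ρ` in the Witten `L`-function of `G`. -/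
def wittenTerm {G : Type*} [Group G] [TopologicalSpace G] (s : ℂ) (g : G)
    (ρ : UnitaryDual G) : ℂ :=
  ρ.trace g / (ρ.deg : ℂ) * (ρ.deg : ℂ) ^ (-s)

/-- The Witten `L`-function of `G` as a series over the unitary dual. -/
def wittenL {G : Type*} [Group G] [TopologicalSpace G] (s : ℂ) (g : G) : ℂ :=
  ∑' ρ : UnitaryDual G, wittenTerm s g ρ

/-- `F` is the meromorphic continuation to `ℂ` of the function `f` given on `U`.  Normal form means
that `F` is analytic at every point that is not a pole (removable singularities are filled in). -/
def IsMeromorphicContinuation (f : ℂ → ℂ) (U : Set ℂ) (F : ℂ → ℂ) : Prop :=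
  MeromorphicNFOn F Set.univ ∧ Set.EqOn F f U

/-- `F` is analytic at `a` with value `v`. -/
def HasRegularValueAt (F : ℂ → ℂ) (v a : ℂ) : Prop :=
  AnalyticAt ℂ F a ∧ F a = v

/-- The group `SU(2)`. -/
abbrev SU2 := Matrix.specialUnitaryGroup (Fin 2) ℂ

/-- The element `diag(e ^ (iθ), e ^ (-iθ))` of `SU(2)`. -/
def diagSU2 (θ : ℝ) : SU2 :=
  ⟨!![exp (I * θ), 0; 0, exp (-(I * θ))], by
    rw [Matrix.mem_specialUnitaryGroup_iff, Matrix.mem_unitaryGroup_iff]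
    constructor
    · ext i j
      fin_cases i <;> fin_cases j <;>
        simp [Matrix.mul_apply, Matrix.star_apply, ← exp_conj, ← exp_add]
    · simp [Matrix.det_fin_two, ← exp_add]⟩

/-- `sin (nθ) / (n sin θ)` for `0 ≤ θ ≤ π` and `n ≥ 1`, with its limit values at the ends:
`1` at `θ = 0` and `(-1) ^ (n - 1)` at `θ = π`. -/
def sinRatio (n : ℕ) (θ : ℝ) : ℝ :=
  if θ = 0 then 1
  else if θ = Real.pi then (-1) ^ (n + 1)
  else Real.sin (n * θ) / (n * Real.sin θ)

end

/-! ### Hurwitz zeta values from the cotangent expansion -/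

section ZetaValues

open Filter Topology HurwitzZeta

/-! The irreducible representations of SU(2) are the symmetric powers of the standard one, one in
each degree n ≥ 1, with character sin(nθ)/sin θ (`bijective_symClass`,
`symChar_diagSU2_eq_sinRatio`). The Witten series is thus a Dirichlet series in n: ζ(s) at θ = 0, -∑
cos(nπ) n^(-s) at θ = π, and ∑ sin(nθ) n^(-s-1) / sin θ in between. Its continuation is given by ζ,
`cosZeta` and `sinZeta`, and the zeros at negative even integers are their trivial zeros.

The functional equation turns the remaining claims into Hurwitz zeta values. At s = -2 its
trigonometric factor has a simple zero, so the derivative is a multiple of the even Hurwitz zeta at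
3 or the odd one at 2. The values at s = -1 for θ > 0 come from the odd function at 1 or the even
one at 2, both read off from the expansion of π cot πx. Since ζ(2, x) is the sum of its even and odd
parts, subtracting the even part π²/(2 sin²(θ/2)) leaves the odd part, a series of positive terms.

For the classification, the character of a further irreducible representation would be orthogonal to
every symmetric power character. By the Clebsch-Gordan recursion it is then orthogonal to every
polynomial in the half trace. Continuous class functions are continuous functions of the half trace,
so by Weierstrass approximation the real part of the character vanishes; but at the identity it is
the dimension (`exists_equiv_symRep`). -/

theorem ofReal_mem_integerComplement {x : ℝ} (h0 : 0 < x) (h1 : x < 1) :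
    (x : ℂ) ∈ Complex.integerComplement := by
  rintro ⟨n, hn⟩
  have h : (n : ℝ) = x := by exact_mod_cast hn
  have h2 : 0 < n := by exact_mod_cast h ▸ h0
  have h3 : n < 1 := by exact_mod_cast h ▸ h1
  omega

theorem hasSum_pi_cot_sub_inv {x : ℝ} (h0 : 0 < x) (h1 : x < 1) :
    HasSum (fun n : ℕ => 1 / (x - (n + 1)) + 1 / (x + (n + 1)))
      (Real.pi * Real.cos (Real.pi * x) / Real.sin (Real.pi * x) - 1 / x) := by
  have hx := ofReal_mem_integerComplement h0 h1
  have h := (summable_cotTerm hx).hasSum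
  have e := cot_series_rep' hx
  unfold cotTerm at h
  rw [← e] at h
  rw [← Complex.hasSum_ofReal]
  convert h using 1
  · ext n; push_cast; rfl
  · rw [Complex.cot]; push_cast; ring

/-- Regrouping of the terms of a symmetric sum over `ℤ + x`. -/
theorem sum_range_regroup {f : ℝ → ℝ} (x : ℝ) (N : ℕ) :
    ∑ n ∈ Finset.range N, (f (x + n) + f (x - (n + 1))) =
      f x - f (x + N) + ∑ n ∈ Finset.range N, (f (x - (n + 1)) + f (x + (n + 1))) := by
  induction N with
  | zero => simp
  | succ N ih =>
    rw [Finset.sum_range_succ, Finset.sum_range_succ, ih]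
    push_cast
    ring

/-- The cotangent series pairs x - (n + 1) with x + (n + 1), while Hurwitz zeta functions pair x + n
with n + 1 - x. The partial sums of the two groupings differ by 1/x and a boundary term 1/(x + N)
that tends to 0. -/
theorem tendsto_sum_inv_sub_inv {x : ℝ} (h0 : 0 < x) (h1 : x < 1) :
    Tendsto (fun N : ℕ => ∑ n ∈ Finset.range N, (1 / (n + x) - 1 / (n + 1 - x))) atTop
      (𝓝 (Real.pi * Real.cos (Real.pi * x) / Real.sin (Real.pi * x))) := by
  have h := (hasSum_pi_cot_sub_inv h0 h1).tendsto_sum_nat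
  have h2 : Tendsto (fun N : ℕ => 1 / (x + N)) atTop (𝓝 0) := by
    simp_rw [one_div]
    exact (tendsto_atTop_add_const_left _ _ tendsto_natCast_atTop_atTop).inv_tendsto_atTop
  have h3 := (h2.const_sub (1 / x)).add h
  convert h3 using 1
  · ext N
    rw [← sum_range_regroup (f := fun y => 1 / y)]
    refine Finset.sum_congr rfl fun n _ => ?_
    rw [show x - (n + 1) = -(n + 1 - x) by ring, div_neg, ← sub_eq_add_neg, add_comm x]
  · congr 1; ring

theorem hasDerivAt_pi_cot {x : ℝ} (h0 : 0 < x) (h1 : x < 1) :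
    HasDerivAt (fun x : ℝ => Real.pi * Real.cos (Real.pi * x) / Real.sin (Real.pi * x) - 1 / x)
      (-(Real.pi ^ 2 / Real.sin (Real.pi * x) ^ 2) + 1 / x ^ 2) x := by
  have hs : Real.sin (Real.pi * x) ≠ 0 :=
    (Real.sin_pos_of_pos_of_lt_pi (by positivity) (by nlinarith [Real.pi_pos])).ne'
  have hl : HasDerivAt (fun x : ℝ => Real.pi * x) Real.pi x := by
    simpa using (hasDerivAt_id x).const_mul Real.pi
  have hc := (hl.cos.const_mul Real.pi).div hl.sin hs
  have hi := hasDerivAt_inv h0.ne'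
  convert! hc.sub hi using 1
  · ext y; simp
  · have := Real.sin_sq_add_cos_sq (Real.pi * x)
    field_simp
    linear_combination (Real.pi ^ 2 * x ^ 2) * this

/-- Termwise differentiation of the cotangent series. -/
theorem hasSum_inv_sq {x : ℝ} (h0 : 0 < x) (h1 : x ≤ 1 / 2) :
    HasSum (fun n : ℕ => 1 / (x - (n + 1)) ^ 2 + 1 / (x + (n + 1)) ^ 2)
      (Real.pi ^ 2 / Real.sin (Real.pi * x) ^ 2 - 1 / x ^ 2) := by
  -- On (0, 3/4), a neighbourhood of x that avoids the pole at 1, one has n + 1 - y ≥ (n + 1)/4. The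
  -- two terms are then at most 16/(n + 1)² and 1/(n + 1)², and 32 exceeds 17.
  let u : ℕ → ℝ := fun n => 32 * (1 / ((n : ℝ) + 1) ^ 2)
  have hu : Summable u := by
    have := (summable_nat_add_iff 1).2 (Real.summable_one_div_nat_pow.2 one_lt_two)
    simpa [u] using this.mul_left 32
  have hb : ∀ (n : ℕ) (y : ℝ), y ∈ Set.Ioo (0 : ℝ) (3 / 4) →
      ‖-(1 / (y - (n + 1)) ^ 2) + -(1 / (y + (n + 1)) ^ 2)‖ ≤ u n := by
    intro n y ⟨hy0, hy1⟩
    have hn : (0 : ℝ) ≤ n := n.cast_nonneg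
    rw [← neg_add, norm_neg, Real.norm_of_nonneg (by positivity)]
    have e1 : 1 / (y - (n + 1)) ^ 2 ≤ 16 * (1 / ((n : ℝ) + 1) ^ 2) := by
      have : ((n : ℝ) + 1) ^ 2 / 16 ≤ (y - (n + 1)) ^ 2 := by nlinarith
      calc 1 / (y - (n + 1)) ^ 2 ≤ 1 / (((n : ℝ) + 1) ^ 2 / 16) := by gcongr
        _ = _ := by field_simp
    have e2 : 1 / (y + (n + 1)) ^ 2 ≤ 1 / ((n : ℝ) + 1) ^ 2 :=
      one_div_le_one_div_of_le (by positivity) (by nlinarith)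
    have e3 : 0 ≤ 1 / ((n : ℝ) + 1) ^ 2 := by positivity
    simp only [u]; linarith
  have hd := hasDerivAt_tsum_of_isPreconnected (𝕜 := ℝ) (u := u)
    (g := fun (n : ℕ) (y : ℝ) => 1 / (y - (n + 1)) + 1 / (y + (n + 1)))
    (g' := fun (n : ℕ) (y : ℝ) => -(1 / (y - (n + 1)) ^ 2) + -(1 / (y + (n + 1)) ^ 2))
    hu (isOpen_Ioo (a := (0 : ℝ)) (b := 3 / 4)) isPreconnected_Ioo ?_ hb
    (y₀ := x) (y := x) ⟨h0, by linarith⟩ (hasSum_pi_cot_sub_inv h0 (by linarith)).summable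
    ⟨h0, by linarith⟩
  · have hd2 := hasDerivAt_pi_cot h0 (by linarith : x < 1)
    have hev : (fun z : ℝ => ∑' n : ℕ, (1 / (z - (n + 1)) + 1 / (z + (n + 1)))) =ᶠ[𝓝 x]
        fun x : ℝ => Real.pi * Real.cos (Real.pi * x) / Real.sin (Real.pi * x) - 1 / x := by
      filter_upwards [isOpen_Ioo.mem_nhds (show x ∈ Set.Ioo (0 : ℝ) 1 from ⟨h0, by linarith⟩)]
        with z hz
      exact (hasSum_pi_cot_sub_inv hz.1 hz.2).tsum_eq
    have he := (hd.congr_of_eventuallyEq hev.symm).unique hd2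
    have hsum : Summable fun n : ℕ => -(1 / (x - (n + 1)) ^ 2) + -(1 / (x + (n + 1)) ^ 2) :=
      Summable.of_norm_bounded hu fun n => hb n x ⟨h0, by linarith⟩
    have := (he ▸ hsum.hasSum).neg
    rw [neg_add, neg_neg, ← sub_eq_add_neg] at this
    exact this.congr_fun fun n => by rw [neg_add, neg_neg, neg_neg]
  · intro n y ⟨hy0, hy1⟩
    have hn : (0 : ℝ) ≤ n := n.cast_nonneg
    have a1 : HasDerivAt (fun y : ℝ => (y - (n + 1))⁻¹) (-1 / (y - (n + 1)) ^ 2) y :=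
      ((hasDerivAt_id y).sub_const _).inv (by simp only [id]; linarith)
    have a2 : HasDerivAt (fun y : ℝ => (y + (n + 1))⁻¹) (-1 / (y + (n + 1)) ^ 2) y :=
      ((hasDerivAt_id y).add_const _).inv (by simp only [id]; linarith)
    convert! a1.add a2 using 1
    · ext z; simp
    · ring

theorem hurwitzZetaEven_two {x : ℝ} (h0 : 0 < x) (h1 : x ≤ 1 / 2) :
    hurwitzZetaEven (x : UnitAddCircle) 2 =
      (Real.pi : ℂ) ^ 2 / (2 * (Real.sin (Real.pi * x) : ℂ) ^ 2) := by
  have h := (hasSum_nat_hurwitzZetaEven_of_mem_Icc (a := x) ⟨h0.le, by linarith⟩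
    (s := 2) (by simp)).tendsto_sum_nat
  have h2 := (hasSum_inv_sq h0 h1).tendsto_sum_nat
  have h3 : Tendsto (fun N : ℕ => 1 / (x + N) ^ 2) atTop (𝓝 0) := by
    have : Tendsto (fun N : ℕ => (x + N)⁻¹) atTop (𝓝 0) :=
      (tendsto_atTop_add_const_left _ _ tendsto_natCast_atTop_atTop).inv_tendsto_atTop
    simpa using this.pow 2
  have h4 := (((h3.const_sub (1 / x ^ 2)).add h2).div_const 2)
  have h5 := (Complex.continuous_ofReal.tendsto _).comp h4
  refine tendsto_nhds_unique h ?_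
  convert h5 using 1
  · ext N
    simp only [Function.comp]
    rw [← sum_range_regroup (f := fun y => 1 / y ^ 2), Finset.sum_div]
    push_cast
    refine Finset.sum_congr rfl fun n _ => ?_
    rw [cpow_ofNat, cpow_ofNat]
    congr 3
    · ring
    · ring
  · congr 1; push_cast; field_simp; ring

end ZetaValues

/-! ### Values and derivatives of the periodic zeta functions at nonpositive integers -/

section ZetaValues

open Filter Topology HurwitzZeta

/-- The series formula for the odd Hurwitz zeta function is used only for Re s > 1, so the value at
1 is reached by letting s decrease to 1: the function is entire, and the paired series converges
dominatedly. -/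
theorem hurwitzZetaOdd_one {x : ℝ} (h0 : 0 < x) (h1 : x ≤ 1 / 2) :
    hurwitzZetaOdd (x : UnitAddCircle) 1 =
      (Real.pi : ℂ) * Real.cos (Real.pi * x) / (2 * Real.sin (Real.pi * x)) := by
  let f : ℝ → ℕ → ℝ := fun s n =>
    (1 / ((n : ℝ) + x) ^ s - 1 / ((n : ℝ) + 1 - x) ^ s) / 2
  let u : ℕ → ℝ := fun n => (1 + 1 / x) * (1 / |(n : ℝ) + x| ^ (2 : ℝ))
  have hu : Summable u := ((Real.summable_one_div_nat_add_rpow x 2).2 one_lt_two).mul_left _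
  have hfb : ∀ s ∈ Set.Icc (1 : ℝ) 2, ∀ n, ‖f s n‖ ≤ u n := by
    intro s ⟨hs1, hs2⟩ n
    have hn : (0 : ℝ) ≤ n := n.cast_nonneg
    set p : ℝ := n + x with hp
    set q : ℝ := n + 1 - x with hq
    have hp0 : 0 < p := by positivity
    have hxp : x ≤ p := by simp [hp]
    have hpq : p ≤ q := by rw [hp, hq]; linarith
    have hq0 : 0 < q := hp0.trans_le hpq
    have hqp : q - p ≤ 1 := by rw [hp, hq]; linarith
    have hle : p ^ s ≤ q ^ s := Real.rpow_le_rpow hp0.le hpq (by linarith)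
    have hps : 0 < p ^ s := Real.rpow_pos_of_pos hp0 s
    have hqs : 0 < q ^ s := Real.rpow_pos_of_pos hq0 s
    -- Bernoulli's inequality gives 1 - (p/q)^s ≤ s (1 - p/q) ≤ 2/p, using s ≤ 2 and q - p ≤ 1. The
    -- pairing thus gains a factor 1/p, which makes the bound summable uniformly in s.
    have hb : 1 + s * (p / q - 1) ≤ (p / q) ^ s := by
      have := one_add_mul_self_le_rpow_one_add (s := p / q - 1)
        (by have : 0 < p / q := by positivity
            linarith) hs1
      simpa using this
    rw [Real.div_rpow hp0.le hq0.le] at hb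
    have hinv : 1 / p ^ s ≤ 1 / p + 1 / p ^ 2 := by
      rcases le_total 1 p with h | h
      · have : p ≤ p ^ s := by simpa using Real.rpow_le_rpow_of_exponent_le h hs1
        have : 1 / p ^ s ≤ 1 / p := one_div_le_one_div_of_le hp0 this
        have : 0 < 1 / p ^ 2 := by positivity
        linarith
      · have : p ^ (2 : ℝ) ≤ p ^ s := Real.rpow_le_rpow_of_exponent_ge hp0 h hs2
        rw [Real.rpow_two] at this
        have : 1 / p ^ s ≤ 1 / p ^ 2 := one_div_le_one_div_of_le (by positivity) this
        have : 0 < 1 / p := by positivity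
        linarith
    have key : (1 / p ^ s - 1 / q ^ s) / 2 ≤ (1 / p ^ s) * (1 / p) := by
      have e : 1 / p ^ s - 1 / q ^ s = (1 / p ^ s) * (1 - p ^ s / q ^ s) := by field_simp
      rw [e, mul_div_assoc]
      refine mul_le_mul_of_nonneg_left ?_ (by positivity)
      have : 1 - p / q ≤ 1 / p := by
        rw [one_sub_div hq0.ne', div_le_div_iff₀ hq0 hp0]
        nlinarith
      have : 0 ≤ 1 - p / q := by
        rw [sub_nonneg, div_le_one hq0]; exact hpq
      nlinarith
    have hnn : 0 ≤ (1 / p ^ s - 1 / q ^ s) / 2 := by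
      have := one_div_le_one_div_of_le hps hle
      linarith
    have : ‖f s n‖ = (1 / p ^ s - 1 / q ^ s) / 2 := Real.norm_of_nonneg hnn
    rw [this]
    refine key.trans ((mul_le_mul_of_nonneg_right hinv (by positivity)).trans ?_)
    simp only [u]
    rw [← hp, abs_of_pos hp0, Real.rpow_two]
    have : 1 / p ≤ 1 / x := one_div_le_one_div_of_le h0 hxp
    have e : (1 / p + 1 / p ^ 2) * (1 / p) = (1 + 1 / p) * (1 / p ^ 2) := by field_simp
    rw [e]
    gcongr
  have hlim : Tendsto (fun s : ℝ => ∑' n, f s n) (𝓝[>] 1) (𝓝 (∑' n, f 1 n)) := by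
    refine tendsto_tsum_of_dominated_convergence hu (fun n => ?_) ?_
    · have hn : (0 : ℝ) ≤ n := n.cast_nonneg
      have c1 : 0 < (n : ℝ) + x := by positivity
      have c2 : 0 < (n : ℝ) + 1 - x := by linarith
      have : ContinuousAt (fun s => f s n) 1 := by
        have d1 : ContinuousAt (fun s : ℝ => ((n : ℝ) + x) ^ s) 1 :=
          Real.continuousAt_const_rpow c1.ne'
        have d2 : ContinuousAt (fun s : ℝ => ((n : ℝ) + 1 - x) ^ s) 1 :=
          Real.continuousAt_const_rpow c2.ne'
        exact ((continuousAt_const.div d1 (Real.rpow_pos_of_pos c1 1).ne').sub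
          (continuousAt_const.div d2 (Real.rpow_pos_of_pos c2 1).ne')).div_const 2
      exact this.tendsto.mono_left nhdsWithin_le_nhds
    · have : Set.Ioc (1 : ℝ) 2 ∈ 𝓝[>] (1 : ℝ) := Ioc_mem_nhdsGT one_lt_two
      filter_upwards [this] with s hs n using hfb s ⟨hs.1.le, hs.2⟩ n
  have hval : ∑' n, f 1 n = Real.pi * Real.cos (Real.pi * x) / Real.sin (Real.pi * x) / 2 := by
    have hs : Summable (f 1) := Summable.of_norm_bounded hu (hfb 1 ⟨le_rfl, one_le_two⟩)
    refine tendsto_nhds_unique hs.hasSum.tendsto_sum_nat ?_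
    convert (tendsto_sum_inv_sub_inv h0 (by linarith : x < 1)).div_const 2 using 1
    ext N
    rw [Finset.sum_div]
    simp only [f, Real.rpow_one]
  have hcont : Tendsto (fun s : ℝ => hurwitzZetaOdd (x : UnitAddCircle) (s : ℂ)) (𝓝[>] 1)
      (𝓝 (hurwitzZetaOdd (x : UnitAddCircle) 1)) := by
    have := ((differentiable_hurwitzZetaOdd (x : UnitAddCircle)).continuous.comp
      Complex.continuous_ofReal).tendsto 1
    simp only [Function.comp_apply, Complex.ofReal_one] at this
    exact this.mono_left nhdsWithin_le_nhds
  have hlim2 : Tendsto (fun s : ℝ => ((∑' n, f s n : ℝ) : ℂ)) (𝓝[>] 1)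
      (𝓝 ((∑' n, f 1 n : ℝ) : ℂ)) := (Complex.continuous_ofReal.tendsto _).comp hlim
  rw [tendsto_nhds_unique_of_eventuallyEq hcont hlim2 ?_, hval]
  · push_cast; field_simp
  · filter_upwards [self_mem_nhdsWithin] with s hs
    rw [Complex.ofReal_tsum, ← (hasSum_nat_hurwitzZetaOdd_of_mem_Icc (a := x)
      ⟨h0.le, by linarith⟩ (s := s) (by simpa using hs)).tsum_eq]
    refine tsum_congr fun n => ?_
    have hn : (0 : ℝ) ≤ n := n.cast_nonneg
    simp only [f]
    push_cast [Complex.ofReal_cpow (by positivity : 0 ≤ (n : ℝ) + x),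
      Complex.ofReal_cpow (by linarith : 0 ≤ (n : ℝ) + 1 - x)]
    rfl

theorem sinZeta_zero {x : ℝ} (h0 : 0 < x) (h1 : x ≤ 1 / 2) :
    sinZeta (x : UnitAddCircle) 0 =
      (Real.cos (Real.pi * x) : ℂ) / (2 * Real.sin (Real.pi * x)) := by
  have h := sinZeta_one_sub (x : UnitAddCircle) (s := 1) (fun n hn => by
    have := congrArg Complex.re hn
    simp at this
    have hn : (0 : ℝ) ≤ n := n.cast_nonneg
    linarith)
  rw [sub_self, hurwitzZetaOdd_one h0 h1] at h
  rw [h, Complex.cpow_neg_one, Complex.Gamma_one, mul_one, mul_one, Complex.sin_pi_div_two]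
  have : (Real.pi : ℂ) ≠ 0 := Complex.ofReal_ne_zero.2 Real.pi_ne_zero
  field_simp

/-- For x < 1/2 each n + x is smaller than n + 1 - x, so every paired term is positive. This is the
source of the positivity of the derivative at -2. -/
theorem exists_hurwitzZetaOdd_two_eq {x : ℝ} (h0 : 0 < x) (h1 : x < 1 / 2) :
    ∃ d : ℝ, 0 < d ∧ hurwitzZetaOdd (x : UnitAddCircle) 2 = d := by
  have h := hasSum_nat_hurwitzZetaOdd_of_mem_Icc (a := x) ⟨h0.le, by linarith⟩
    (s := 2) (by simp)
  let f : ℕ → ℝ := fun n => (1 / ((n : ℝ) + x) ^ 2 - 1 / ((n : ℝ) + 1 - x) ^ 2) / 2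
  have hf : ∀ n, 0 < f n := fun n => by
    have hn : (0 : ℝ) ≤ n := n.cast_nonneg
    have : 1 / ((n : ℝ) + 1 - x) ^ 2 < 1 / ((n : ℝ) + x) ^ 2 :=
      one_div_lt_one_div_of_lt (by positivity)
        (pow_lt_pow_left₀ (by linarith) (by positivity) two_ne_zero)
    simp only [f]; linarith
  have h2 : HasSum (fun n => (f n : ℂ)) (hurwitzZetaOdd (x : UnitAddCircle) 2) := by
    convert h using 1
    ext n
    simp only [f]
    rw [cpow_ofNat, cpow_ofNat]
    push_cast
    rfl
  have hs : Summable f := Complex.summable_ofReal.1 h2.summable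
  exact ⟨∑' n, f n, hs.tsum_pos (fun n => (hf n).le) 0 (hf 0),
    h2.unique (Complex.hasSum_ofReal.2 hs.hasSum)⟩

/-- The derivative of the product of a function with a differentiable function vanishing there. -/
theorem HasDerivAt.mul_of_eq_zero {f g : ℂ → ℂ} {f' a : ℂ} (hf : HasDerivAt f f' a)
    (ha : f a = 0) (hg : DifferentiableAt ℂ g a) :
    HasDerivAt (fun s => f s * g s) (f' * g a) a := by
  have h := hf.fun_mul hg.hasDerivAt
  rwa [ha, zero_mul, add_zero] at h

theorem differentiableAt_two_pi_cpow_mul_Gamma {a : ℂ} (ha : 0 < a.re) :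
    DifferentiableAt ℂ (fun s : ℂ => 2 * (2 * (Real.pi : ℂ)) ^ (-s) * Gamma s) a := by
  have h2 : (2 * (Real.pi : ℂ)) ≠ 0 :=
    mul_ne_zero two_ne_zero (Complex.ofReal_ne_zero.2 Real.pi_ne_zero)
  refine DifferentiableAt.mul ?_ (Complex.differentiableAt_Gamma _ fun m hm => ?_)
  · exact (differentiableAt_id.neg.const_cpow (Or.inl h2)).const_mul 2
  · rw [hm] at ha
    simp at ha
    have hn : (0 : ℝ) ≤ m := m.cast_nonneg
    linarith

theorem ne_neg_natCast_of_re_pos {s : ℂ} (hs : 0 < s.re) (n : ℕ) : s ≠ -n := by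
  rintro rfl
  simp at hs
  have hn : (0 : ℝ) ≤ n := n.cast_nonneg
  linarith

theorem hasDerivAt_pi_mul_div_two (a : ℂ) :
    HasDerivAt (fun s : ℂ => (Real.pi : ℂ) * s / 2) (Real.pi / 2) a := by
  simpa using ((hasDerivAt_id a).const_mul (Real.pi : ℂ)).div_const 2

/-- In the functional equation s ↦ 1 - s the factor sin(πs/2) vanishes at s = 2, so only its
derivative -π/2 contributes, multiplied by the value of the other factors there. -/
theorem hasDerivAt_sinZeta_neg_one (a : UnitAddCircle) :
    HasDerivAt (sinZeta a) (hurwitzZetaOdd a 2 / (4 * Real.pi)) (-1) := by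
  have hpi : (Real.pi : ℂ) ≠ 0 := Complex.ofReal_ne_zero.2 Real.pi_ne_zero
  have hs : HasDerivAt (fun s : ℂ => Complex.sin (Real.pi * s / 2)) (-(Real.pi / 2)) 2 := by
    have := (hasDerivAt_pi_mul_div_two 2).csin
    simpa using this
  have h1 := hs.mul_of_eq_zero (by simp) (g := fun s => 2 * (2 * (Real.pi : ℂ)) ^ (-s) * Gamma s *
    hurwitzZetaOdd a s) ((differentiableAt_two_pi_cpow_mul_Gamma (by simp)).mul
      (differentiable_hurwitzZetaOdd a 2))
  have h2 : HasDerivAt (fun s => sinZeta a (1 - s)) (-(hurwitzZetaOdd a 2 / (4 * Real.pi))) 2 := by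
    have hev : (fun s => sinZeta a (1 - s)) =ᶠ[𝓝 2] fun s => Complex.sin (Real.pi * s / 2) *
        (2 * (2 * (Real.pi : ℂ)) ^ (-s) * Gamma s * hurwitzZetaOdd a s) := by
      have : {s : ℂ | 0 < s.re} ∈ 𝓝 (2 : ℂ) :=
        (isOpen_lt continuous_const Complex.continuous_re).mem_nhds (by simp)
      filter_upwards [this] with s hs
      rw [sinZeta_one_sub a (ne_neg_natCast_of_re_pos hs)]
      ring
    convert! h1.congr_of_eventuallyEq hev using 1
    have : Gamma 2 = 1 := by simp
    rw [Complex.cpow_neg, cpow_ofNat, this]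
    field_simp
    norm_num
  have h3 : HasDerivAt (fun s : ℂ => 1 - s) (-1) (-1) := by
    simpa using (hasDerivAt_id (-1 : ℂ)).const_sub 1
  have h4 : HasDerivAt (fun s => sinZeta a (1 - s)) (-(hurwitzZetaOdd a 2 / (4 * Real.pi)))
    ((fun s : ℂ => 1 - s) (-1)) := by
    convert h2 using 1; norm_num
  have h5 := h4.comp (-1) h3
  convert! h5 using 1
  · ext s; simp
  · ring

/-- Now cos(πs/2) vanishes at s = 3, with derivative π/2. The point 3 is away from the possible pole
at 1, so the class 0, which gives ζ itself, is included. -/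
theorem hasDerivAt_cosZeta_neg_two (a : UnitAddCircle) :
    HasDerivAt (cosZeta a) (-(hurwitzZetaEven a 3 / (4 * (Real.pi : ℂ) ^ 2))) (-2) := by
  have hpi : (Real.pi : ℂ) ≠ 0 := Complex.ofReal_ne_zero.2 Real.pi_ne_zero
  have e3 : (Real.pi : ℂ) * 3 / 2 = Real.pi / 2 + Real.pi := by ring
  have hs : HasDerivAt (fun s : ℂ => Complex.cos (Real.pi * s / 2)) (Real.pi / 2) 3 := by
    have := (hasDerivAt_pi_mul_div_two 3).ccos
    rw [e3, Complex.sin_add_pi, Complex.sin_pi_div_two] at this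
    simpa using this
  have h1 := hs.mul_of_eq_zero (by rw [e3, Complex.cos_add_pi, Complex.cos_pi_div_two, neg_zero])
    (g := fun s => 2 * (2 * (Real.pi : ℂ)) ^ (-s) * Gamma s *
    hurwitzZetaEven a s) ((differentiableAt_two_pi_cpow_mul_Gamma (by simp)).mul
      (differentiableAt_hurwitzZetaEven a (by norm_num)))
  have h2 : HasDerivAt (fun s => cosZeta a (1 - s))
      (hurwitzZetaEven a 3 / (4 * (Real.pi : ℂ) ^ 2)) 3 := by
    have hev : (fun s => cosZeta a (1 - s)) =ᶠ[𝓝 3] fun s => Complex.cos (Real.pi * s / 2) *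
        (2 * (2 * (Real.pi : ℂ)) ^ (-s) * Gamma s * hurwitzZetaEven a s) := by
      have : {s : ℂ | 1 < s.re} ∈ 𝓝 (3 : ℂ) :=
        (isOpen_lt continuous_const Complex.continuous_re).mem_nhds (by simp)
      filter_upwards [this] with s hs
      rw [cosZeta_one_sub a fun n hn => ?_]
      · ring
      · rw [hn] at hs
        simp at hs
        have hn : (0 : ℝ) ≤ n := n.cast_nonneg
        linarith
    convert! h1.congr_of_eventuallyEq hev using 1
    have : Gamma 3 = 2 := by
      rw [show (3 : ℂ) = (2 : ℕ) + 1 by norm_num, Complex.Gamma_nat_eq_factorial]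
      simp
    rw [Complex.cpow_neg, cpow_ofNat, this]
    field_simp
    norm_num
  have h3 : HasDerivAt (fun s : ℂ => 1 - s) (-1) (-2) := by
    simpa using (hasDerivAt_id (-2 : ℂ)).const_sub 1
  have h4 : HasDerivAt (fun s => cosZeta a (1 - s))
      (hurwitzZetaEven a 3 / (4 * (Real.pi : ℂ) ^ 2)) ((fun s : ℂ => 1 - s) (-2)) := by
    convert h2 using 1; norm_num
  have h5 := h4.comp (-2) h3
  convert! h5 using 1
  · ext s; simp
  · ring

theorem cosZeta_neg_one (a : UnitAddCircle) :
    cosZeta a (-1) = -(hurwitzZetaEven a 2 / (2 * (Real.pi : ℂ) ^ 2)) := by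
  have hpi : (Real.pi : ℂ) ≠ 0 := Complex.ofReal_ne_zero.2 Real.pi_ne_zero
  have h := cosZeta_one_sub a (s := 2) (fun n hn => by
    have := congrArg Complex.re hn
    simp at this
    have hn : (0 : ℝ) ≤ n := n.cast_nonneg
    linarith)
  have hG : Gamma 2 = 1 := by simp
  rw [show (1 : ℂ) - 2 = -1 by norm_num, Complex.cpow_neg, cpow_ofNat, hG,
    mul_div_cancel_right₀ _ two_ne_zero, Complex.cos_pi] at h
  rw [h]
  field_simp

/-- At 1/2 the paired terms coincide and the series is 8 ∑ (2n + 1)^(-3). The even integers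
contribute ζ(3)/8 to ζ(3), leaving 7ζ(3)/8 for the odd ones. -/
theorem hurwitzZetaEven_half_three :
    hurwitzZetaEven ((1 / 2 : ℝ) : UnitAddCircle) 3 = 7 * riemannZeta 3 := by
  have h := hasSum_nat_hurwitzZetaEven_of_mem_Icc (a := 1 / 2) (by norm_num) (s := 3) (by simp)
  have h1 : HasSum (fun n : ℕ => 8 * (1 / ((2 * n + 1 : ℕ) : ℂ) ^ 3))
      (hurwitzZetaEven ((1 / 2 : ℝ) : UnitAddCircle) 3) := by
    convert h using 1
    ext n
    rw [cpow_ofNat, cpow_ofNat]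
    have hn : (2 * (n : ℂ) + 1) ≠ 0 := by exact_mod_cast (Nat.succ_ne_zero (2 * n))
    have e1 : (n : ℂ) + ((1 / 2 : ℝ) : ℂ) = (2 * n + 1) / 2 := by push_cast; ring
    have e2 : (n : ℂ) + 1 - ((1 / 2 : ℝ) : ℂ) = (2 * n + 1) / 2 := by push_cast; ring
    rw [e1, e2]
    push_cast
    field_simp
    norm_num
  have hz : HasSum (fun n : ℕ => 1 / (n : ℂ) ^ 3) (riemannZeta 3) := by
    have hs : Summable (fun n : ℕ => 1 / (n : ℂ) ^ 3) := by
      have := Complex.summable_one_div_nat_cpow (p := 3)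
      simpa using this.2 (by simp)
    have := zeta_nat_eq_tsum_of_gt_one (k := 3) (by norm_num)
    push_cast at this
    rw [this]
    exact hs.hasSum
  have he : HasSum (fun n : ℕ => 1 / ((2 * n : ℕ) : ℂ) ^ 3) (riemannZeta 3 / 8) := by
    refine (hz.div_const 8).congr_fun fun n => ?_
    push_cast
    rw [mul_pow, one_div, mul_inv]
    ring
  have ho : HasSum (fun n : ℕ => 1 / ((2 * n + 1 : ℕ) : ℂ) ^ 3)
      (hurwitzZetaEven ((1 / 2 : ℝ) : UnitAddCircle) 3 / 8) := by
    exact (h1.div_const 8).congr_fun fun n => by ring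
  have := (HasSum.even_add_odd (f := fun n : ℕ => 1 / (n : ℂ) ^ 3) he ho).unique hz
  linear_combination 8 * this

end ZetaValues

/-! ### Meromorphic continuation of the Dirichlet series -/

section Continuation

open Filter Topology HurwitzZeta

theorem differentiable_meromorphicNFOn_univ {f : ℂ → ℂ} (hf : Differentiable ℂ f) :
    MeromorphicNFOn f Set.univ :=
  fun z _ => (hf.analyticAt z).meromorphicNFAt

/-- At the pole, ζ is the sum of a function analytic there and 1/((s - 1) Γ_ℝ(s)). -/
theorem meromorphicOn_riemannZeta : MeromorphicOn riemannZeta Set.univ := by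
  intro s _
  rcases eq_or_ne s 1 with rfl | hs
  · have hd : ∀ᶠ z in 𝓝 (1 : ℂ), DifferentiableAt ℂ
        (fun s => hurwitzZetaEven 0 s - 1 / (s - 1) / Gammaℝ s) z := by
      filter_upwards [(isOpen_lt continuous_const Complex.continuous_re).mem_nhds
        (show (0 : ℝ) < (1 : ℂ).re by simp)] with z hz
      rcases eq_or_ne z 1 with rfl | hz1
      · exact differentiableAt_hurwitzZetaEven_sub_one_div 0
      · refine (differentiableAt_hurwitzZetaEven 0 hz1).sub ?_
        simp_rw [div_eq_mul_inv]
        refine DifferentiableAt.mul ?_ (differentiable_Gammaℝ_inv z)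
        exact (((differentiableAt_id (𝕜 := ℂ)).sub_const (1 : ℂ)).fun_inv
          (sub_ne_zero.2 hz1)).const_mul 1
    have ha : AnalyticAt ℂ (fun s => hurwitzZetaEven 0 s - 1 / (s - 1) / Gammaℝ s) 1 :=
      Complex.analyticAt_iff_eventually_differentiableAt.2 hd
    have hG : AnalyticAt ℂ (fun s => (Gammaℝ s)⁻¹) 1 := differentiable_Gammaℝ_inv.analyticAt 1
    have hi : MeromorphicAt (fun s : ℂ => (s - 1)⁻¹) 1 :=
      ((analyticAt_id.sub analyticAt_const).meromorphicAt).inv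
    have := ha.meromorphicAt.add (hi.mul hG.meromorphicAt)
    refine this.congr (Eventually.of_forall fun z => ?_)
    simp only [Pi.add_apply, Pi.mul_apply, ← hurwitzZetaEven_zero]
    ring
  · exact (analyticOn_riemannZeta s hs).meromorphicAt

/-- Normal form prescribes the value at a pole, so `riemannZeta` is replaced by its normal form;
away from 1 nothing changes. -/
theorem toMeromorphicNFOn_riemannZeta_eq {s : ℂ} (hs : s ≠ 1) :
    toMeromorphicNFOn riemannZeta Set.univ s = riemannZeta s := by
  rw [toMeromorphicNFOn_eq_toMeromorphicNFAt meromorphicOn_riemannZeta (Set.mem_univ s),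
    toMeromorphicNFAt_eq_self.2 (analyticOn_riemannZeta s hs).meromorphicNFAt]

theorem toMeromorphicNFOn_riemannZeta_eventuallyEq {s : ℂ} (hs : s ≠ 1) :
    toMeromorphicNFOn riemannZeta Set.univ =ᶠ[𝓝 s] riemannZeta := by
  filter_upwards [isOpen_compl_singleton.mem_nhds hs] with z hz
  exact toMeromorphicNFOn_riemannZeta_eq hz

/-- The meromorphic continuation of `∑ sinRatio n θ * n ^ (-s)` for `0 ≤ θ ≤ π`. -/
noncomputable def sinRatioLSeries (θ : ℝ) : ℂ → ℂ :=
  if θ = 0 then toMeromorphicNFOn riemannZeta Set.univ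
  else if θ = Real.pi then fun s => -cosZeta ((1 / 2 : ℝ) : UnitAddCircle) s
  else fun s => sinZeta ((θ / (2 * Real.pi) : ℝ) : UnitAddCircle) (s + 1) / (Real.sin θ : ℂ)

theorem sinRatioLSeries_zero :
    sinRatioLSeries 0 = toMeromorphicNFOn riemannZeta Set.univ := if_pos rfl

theorem sinRatioLSeries_pi :
    sinRatioLSeries Real.pi = fun s => -cosZeta ((1 / 2 : ℝ) : UnitAddCircle) s := by
  rw [sinRatioLSeries, if_neg Real.pi_ne_zero, if_pos rfl]

theorem sinRatioLSeries_of_mem_Ioo {θ : ℝ} (h0 : 0 < θ) (h1 : θ < Real.pi) :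
    sinRatioLSeries θ = fun s =>
      sinZeta ((θ / (2 * Real.pi) : ℝ) : UnitAddCircle) (s + 1) / (Real.sin θ : ℂ) := by
  rw [sinRatioLSeries, if_neg h0.ne', if_neg h1.ne]

theorem half_ne_zero_unitAddCircle : ((1 / 2 : ℝ) : UnitAddCircle) ≠ 0 := by
  intro h
  obtain ⟨n, hn⟩ := (AddCircle.coe_eq_zero_iff 1).1 h
  have h2 : ((2 * n : ℤ) : ℝ) = (1 : ℤ) := by
    push_cast
    simp at hn
    linarith
  have := Int.cast_injective h2
  omega

theorem differentiable_sinZeta_shift (a : UnitAddCircle) (c : ℂ) :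
    Differentiable ℂ fun s => sinZeta a (s + 1) / c :=
  ((differentiableAt_sinZeta a).comp (differentiable_id.add_const 1)).div_const c

theorem meromorphicNFOn_sinRatioLSeries (θ : ℝ) :
    MeromorphicNFOn (sinRatioLSeries θ) Set.univ := by
  unfold sinRatioLSeries
  split_ifs
  · exact meromorphicNFOn_toMeromorphicNFOn riemannZeta Set.univ
  · exact differentiable_meromorphicNFOn_univ
      (differentiable_cosZeta_of_ne_zero half_ne_zero_unitAddCircle).neg
  · exact differentiable_meromorphicNFOn_univ (differentiable_sinZeta_shift _ _)

theorem analyticAt_sinRatioLSeries (θ : ℝ) {s : ℂ} (hs : s ≠ 1) :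
    AnalyticAt ℂ (sinRatioLSeries θ) s := by
  unfold sinRatioLSeries
  split_ifs
  · exact (analyticOn_riemannZeta s hs).congr (toMeromorphicNFOn_riemannZeta_eventuallyEq hs).symm
  · exact (differentiable_cosZeta_of_ne_zero half_ne_zero_unitAddCircle).neg.analyticAt s
  · exact (differentiable_sinZeta_shift _ _).analyticAt s

theorem hasSum_pnat_of_hasSum_nat {f : ℕ → ℂ} {a : ℂ} (h0 : f 0 = 0) (h : HasSum f a) :
    HasSum (fun n : ℕ+ => f n) a := by
  refine (Function.Injective.hasSum_iff PNat.coe_injective ?_).2 h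
  intro n hn
  rcases Nat.eq_zero_or_pos n with rfl | hp
  · exact h0
  · exact absurd ⟨⟨n, hp⟩, rfl⟩ hn

/-- At θ = π the coefficient (-1)^(n+1) is -cos(nπ), hence the class 1/2. For 0 < θ < π the class is
θ/(2π), and the factor 1/n in the coefficient raises the exponent to s + 1. -/
theorem hasSum_sinRatioLSeries {θ : ℝ} (h0 : 0 ≤ θ) (h1 : θ ≤ Real.pi) {s : ℂ} (hs : 1 < s.re) :
    HasSum (fun n : ℕ+ => (sinRatio n θ : ℂ) * (n : ℂ) ^ (-s)) (sinRatioLSeries θ s) := by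
  have hs0 : s ≠ 0 := by rintro rfl; simp at hs; linarith
  have hs1 : s ≠ 1 := by rintro rfl; simp at hs
  rcases h0.eq_or_lt with rfl | h0
  · rw [sinRatioLSeries_zero, toMeromorphicNFOn_riemannZeta_eq hs1]
    have h : HasSum (fun n : ℕ => 1 / (n : ℂ) ^ s) (riemannZeta s) := by
      rw [zeta_eq_tsum_one_div_nat_cpow hs]
      exact (Complex.summable_one_div_nat_cpow.2 hs).hasSum
    refine (hasSum_pnat_of_hasSum_nat (by simp [hs0]) h).congr_fun fun n => ?_
    simp [sinRatio, cpow_neg]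
  rcases h1.eq_or_lt with rfl | h1
  · rw [sinRatioLSeries_pi]
    have h := (hasSum_nat_cosZeta (1 / 2) hs).neg
    refine (hasSum_pnat_of_hasSum_nat (by simp [hs0]) h).congr_fun fun n => ?_
    have : 2 * Real.pi * (1 / 2) * ((n : ℕ) : ℝ) = (n : ℕ) * Real.pi := by ring
    rw [this, Real.cos_nat_mul_pi]
    simp only [sinRatio, if_neg Real.pi_ne_zero, if_true, cpow_neg]
    push_cast
    ring
  · rw [sinRatioLSeries_of_mem_Ioo h0 h1]
    have h := (hasSum_nat_sinZeta (θ / (2 * Real.pi)) (s := s + 1)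
      (by simp; linarith)).div_const (Real.sin θ : ℂ)
    refine (hasSum_pnat_of_hasSum_nat (by simp) h).congr_fun fun n => ?_
    have hn : ((n : ℕ) : ℂ) ≠ 0 := Nat.cast_ne_zero.2 n.ne_zero
    have : 2 * Real.pi * (θ / (2 * Real.pi)) * ((n : ℕ) : ℝ) = (n : ℕ) * θ := by
      field_simp
    rw [this, cpow_add _ _ hn, cpow_one, cpow_neg, sinRatio, if_neg h0.ne', if_neg h1.ne]
    push_cast
    field_simp

/-- These are trivial zeros: the shift to s + 1 sends negative even integers to negative odd ones,
where `sinZeta` vanishes. -/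
theorem sinRatioLSeries_neg_even (θ : ℝ) {m : ℕ} (hm : 0 < m) (he : Even m) :
    sinRatioLSeries θ (-(m : ℂ)) = 0 := by
  obtain ⟨k, rfl⟩ := he
  obtain ⟨k, rfl⟩ : ∃ j, k = j + 1 := ⟨k - 1, by omega⟩
  have e : (-((k + 1 + (k + 1) : ℕ) : ℂ)) = -2 * (k + 1) := by push_cast; ring
  have hne : (-2 * ((k : ℂ) + 1)) ≠ 1 := by
    intro h
    have := congrArg Complex.re h
    simp at this
    have hk : (0 : ℝ) ≤ k := k.cast_nonneg
    linarith
  rw [e]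
  unfold sinRatioLSeries
  split_ifs
  · rw [toMeromorphicNFOn_riemannZeta_eq hne, riemannZeta_neg_two_mul_nat_add_one]
  · simp only [cosZeta_neg_two_mul_nat_add_one, neg_zero]
  · simp only
    rw [show -2 * ((k : ℂ) + 1) + 1 = -2 * k - 1 by ring, sinZeta_neg_two_mul_nat_sub_one, zero_div]

theorem hasDerivAt_sinRatioLSeries_zero :
    HasDerivAt (sinRatioLSeries 0) (-riemannZeta 3 / (4 * (Real.pi : ℂ) ^ 2)) (-2) := by
  rw [sinRatioLSeries_zero]
  refine HasDerivAt.congr_of_eventuallyEq ?_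
    (toMeromorphicNFOn_riemannZeta_eventuallyEq (by norm_num))
  have := hasDerivAt_cosZeta_neg_two 0
  rw [cosZeta_zero, hurwitzZetaEven_zero] at this
  rwa [neg_div]

theorem hasDerivAt_sinRatioLSeries_pi :
    HasDerivAt (sinRatioLSeries Real.pi) (7 * riemannZeta 3 / (4 * (Real.pi : ℂ) ^ 2)) (-2) := by
  rw [sinRatioLSeries_pi]
  have := (hasDerivAt_cosZeta_neg_two ((1 / 2 : ℝ) : UnitAddCircle)).fun_neg
  rwa [neg_neg, hurwitzZetaEven_half_three] at this

/-- The Hurwitz zeta function is its even part plus its odd part, and the subtracted term is the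
even part at 2. The bracket is therefore the positive odd part. -/
theorem hasDerivAt_sinRatioLSeries_of_mem_Ioo {θ : ℝ} (h0 : 0 < θ) (h1 : θ < Real.pi) :
    ∃ d : ℝ, 0 < d ∧
      (d : ℂ) = 1 / (4 * (Real.pi : ℂ) * (Real.sin θ : ℂ)) *
        (hurwitzZeta ((θ / (2 * Real.pi) : ℝ) : UnitAddCircle) 2
          - (Real.pi : ℂ) ^ 2 / (2 * (Real.sin (θ / 2) : ℂ) ^ 2)) ∧
      HasDerivAt (sinRatioLSeries θ) (d : ℂ) (-2) := by
  have hx0 : 0 < θ / (2 * Real.pi) := by positivity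
  have hx1 : θ / (2 * Real.pi) < 1 / 2 := by
    rw [div_lt_div_iff₀ (by positivity) two_pos]; linarith
  obtain ⟨e, he, hed⟩ := exists_hurwitzZetaOdd_two_eq hx0 hx1
  have hsin := Real.sin_pos_of_pos_of_lt_pi h0 h1
  refine ⟨e / (4 * Real.pi) / Real.sin θ, by positivity, ?_, ?_⟩
  · have hE := hurwitzZetaEven_two hx0 hx1.le
    rw [show Real.pi * (θ / (2 * Real.pi)) = θ / 2 by field_simp] at hE
    rw [hurwitzZeta, hE, add_sub_cancel_left, hed]
    push_cast
    have : (Real.pi : ℂ) ≠ 0 := Complex.ofReal_ne_zero.2 Real.pi_ne_zero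
    have : Complex.sin (θ : ℂ) ≠ 0 := by exact_mod_cast hsin.ne'
    field_simp
  · rw [sinRatioLSeries_of_mem_Ioo h0 h1]
    have h := hasDerivAt_sinZeta_neg_one ((θ / (2 * Real.pi) : ℝ) : UnitAddCircle)
    rw [hed, show (-1 : ℂ) = -2 + 1 by norm_num] at h
    have := (h.comp_add_const (-2) 1).div_const (Real.sin θ : ℂ)
    push_cast
    push_cast at this
    exact this

/-- The value is cot(θ/2)/(2 sin θ), simplified by the double angle formula. -/
theorem sinRatioLSeries_neg_one_of_mem_Ioo {θ : ℝ} (h0 : 0 < θ) (h1 : θ < Real.pi) :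
    sinRatioLSeries θ (-1) = 1 / (4 * (Real.sin (θ / 2) : ℂ) ^ 2) := by
  have hx0 : 0 < θ / (2 * Real.pi) := by positivity
  have hx1 : θ / (2 * Real.pi) ≤ 1 / 2 := by
    rw [div_le_div_iff₀ (by positivity) two_pos]; linarith
  rw [sinRatioLSeries_of_mem_Ioo h0 h1]
  simp only
  rw [neg_add_cancel, sinZeta_zero hx0 hx1,
    show Real.pi * (θ / (2 * Real.pi)) = θ / 2 by field_simp]
  have hs : Real.sin θ = 2 * Real.sin (θ / 2) * Real.cos (θ / 2) := by
    rw [← Real.sin_two_mul]; congr 1; ring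
  have h2 : (Real.sin (θ / 2) : ℂ) ≠ 0 :=
    Complex.ofReal_ne_zero.2 (Real.sin_pos_of_pos_of_lt_pi (by linarith) (by linarith)).ne'
  have h3 : (Real.cos (θ / 2) : ℂ) ≠ 0 :=
    Complex.ofReal_ne_zero.2 (Real.cos_pos_of_mem_Ioo ⟨by linarith, by linarith⟩).ne'
  rw [hs, Complex.ofReal_mul, Complex.ofReal_mul]
  push_cast at h2 h3 ⊢
  field_simp
  norm_num

theorem sinRatioLSeries_zero_neg_one : sinRatioLSeries 0 (-1) = -1 / 12 := by
  rw [sinRatioLSeries_zero, toMeromorphicNFOn_riemannZeta_eq (by norm_num)]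
  have := riemannZeta_neg_nat_eq_bernoulli' 1
  rw [bernoulli'_two] at this
  push_cast at this
  rw [this]
  norm_num

theorem sinRatioLSeries_pi_neg_one : sinRatioLSeries Real.pi (-1) = 1 / 4 := by
  rw [sinRatioLSeries_pi]
  simp only
  rw [cosZeta_neg_one, hurwitzZetaEven_two (by norm_num) le_rfl, mul_one_div, Real.sin_pi_div_two]
  have : (Real.pi : ℂ) ≠ 0 := Complex.ofReal_ne_zero.2 Real.pi_ne_zero
  push_cast
  field_simp
  norm_num

theorem analyticOrderAt_eq_one_of_hasDerivAt {f : ℂ → ℂ} {a d : ℂ} (hf : AnalyticAt ℂ f a)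
    (h0 : f a = 0) (hd : HasDerivAt f d a) (hne : d ≠ 0) : analyticOrderAt f a = 1 := by
  have := hf.analyticOrderAt_sub_eq_one_of_deriv_ne_zero (by rwa [hd.deriv])
  simpa [h0] using this

theorem analyticOrderAt_sinRatioLSeries_neg_two {θ : ℝ} (h0 : 0 ≤ θ) (h1 : θ ≤ Real.pi) :
    analyticOrderAt (sinRatioLSeries θ) (-2) = 1 := by
  have ha : AnalyticAt ℂ (sinRatioLSeries θ) (-2) := analyticAt_sinRatioLSeries θ (by norm_num)
  have hz : sinRatioLSeries θ (-2) = 0 := by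
    simpa using sinRatioLSeries_neg_even θ two_pos even_two
  have hzeta : riemannZeta 3 ≠ 0 := riemannZeta_ne_zero_of_one_lt_re (by simp)
  have hpi : (Real.pi : ℂ) ≠ 0 := Complex.ofReal_ne_zero.2 Real.pi_ne_zero
  rcases h0.eq_or_lt with rfl | h0
  · exact analyticOrderAt_eq_one_of_hasDerivAt ha hz hasDerivAt_sinRatioLSeries_zero
      (by simp [hzeta])
  rcases h1.eq_or_lt with rfl | h1
  · exact analyticOrderAt_eq_one_of_hasDerivAt ha hz hasDerivAt_sinRatioLSeries_pi
      (by simp [hzeta])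
  · obtain ⟨d, hd, -, hd2⟩ := hasDerivAt_sinRatioLSeries_of_mem_Ioo h0 h1
    exact analyticOrderAt_eq_one_of_hasDerivAt ha hz hd2 (Complex.ofReal_ne_zero.2 hd.ne')

end Continuation

/-! ### Compactness and conjugacy classes of SU(2) -/

section SU2

open Matrix

instance isTopologicalGroup_specialUnitaryGroup (n : Type*) [Fintype n] [DecidableEq n] :
    IsTopologicalGroup (Matrix.specialUnitaryGroup n ℂ) where
  continuous_inv := by
    refine Continuous.subtype_mk ?_ _
    exact continuous_subtype_val.star

/-- A closed set of matrices with entries in the unit disc. Compactness makes Haar measure finite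
and continuous functions integrable. -/
instance compactSpace_specialUnitaryGroup (n : Type*) [Fintype n] [DecidableEq n] :
    CompactSpace (Matrix.specialUnitaryGroup n ℂ) := by
  refine isCompact_iff_compactSpace.1 ?_
  have hK : IsCompact (Set.univ.pi fun _ : n => Set.univ.pi fun _ : n =>
      Metric.closedBall (0 : ℂ) 1) :=
    isCompact_univ_pi fun _ => isCompact_univ_pi fun _ => isCompact_closedBall _ _
  refine hK.of_isClosed_subset ?_ ?_
  · have h1 : IsClosed {A : Matrix n n ℂ | star A * A = 1} :=
      isClosed_eq (by fun_prop) continuous_const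
    have h2 : IsClosed {A : Matrix n n ℂ | A.det = 1} :=
      isClosed_eq (by fun_prop) continuous_const
    have e : (Matrix.specialUnitaryGroup n ℂ : Set (Matrix n n ℂ)) =
        {A | star A * A = 1} ∩ {A | A.det = 1} := by
      ext A
      exact and_congr mem_unitaryGroup_iff' Iff.rfl
    rw [e]
    exact h1.inter h2
  · intro A hA i _ j _
    rw [mem_closedBall_zero_iff]
    exact entry_norm_bound_of_unitary hA.1 i j

/-- Both are the inverse of g. Comparing entries shows that g is determined by its first column. -/
theorem SU2.star_eq_adjugate (g : SU2) : star (g : Matrix (Fin 2) (Fin 2) ℂ) =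
    adjugate (g : Matrix (Fin 2) (Fin 2) ℂ) := by
  have h1 : star (g : Matrix (Fin 2) (Fin 2) ℂ) * g = 1 := mem_unitaryGroup_iff'.1 g.2.1
  have h2 : (g : Matrix (Fin 2) (Fin 2) ℂ) * adjugate (g : Matrix (Fin 2) (Fin 2) ℂ) = 1 := by
    rw [mul_adjugate, show (g : Matrix (Fin 2) (Fin 2) ℂ).det = 1 from g.2.2, one_smul]
  exact left_inv_eq_right_inv h1 h2

theorem SU2.apply_one_one (g : SU2) : g.1 1 1 = star (g.1 0 0) := by
  have := congrFun (congrFun (SU2.star_eq_adjugate g) 0) 0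
  simpa [adjugate_fin_two] using this.symm

theorem SU2.apply_one_zero (g : SU2) : g.1 1 0 = -star (g.1 0 1) := by
  have := congrFun (congrFun (SU2.star_eq_adjugate g) 1) 0
  simp [adjugate_fin_two] at this
  simp [this]

theorem SU2.apply_zero_one (g : SU2) : g.1 0 1 = -star (g.1 1 0) := by
  simp [SU2.apply_one_zero g]

/-- The element of `SU(2)` with a given first column. -/
def SU2.mk (p q : ℂ) (h : star p * p + star q * q = 1) : SU2 :=
  ⟨!![p, -star q; q, star p], by
    rw [mem_specialUnitaryGroup_iff, mem_unitaryGroup_iff']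
    constructor
    · ext i j
      fin_cases i <;> fin_cases j <;> simp [Matrix.mul_apply] at h ⊢
      · exact h
      · ring
      · ring
      · linear_combination h
    · rw [det_fin_two_of]
      linear_combination h⟩

/-- Half of the trace of an element of `SU(2)`. -/
def SU2.halfTrace (g : SU2) : ℝ := (g.1 0 0).re

theorem SU2.trace_eq (g : SU2) : g.1.trace = 2 * (SU2.halfTrace g : ℂ) := by
  rw [trace_fin_two, SU2.apply_one_one, SU2.halfTrace]
  apply Complex.ext <;> simp
  ring

theorem SU2.halfTrace_mem_Icc (g : SU2) : SU2.halfTrace g ∈ Set.Icc (-1 : ℝ) 1 := by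
  have h := entry_norm_bound_of_unitary g.2.1 0 0
  exact abs_le.1 ((Complex.abs_re_le_norm _).trans h)

theorem SU2.continuous_halfTrace : Continuous SU2.halfTrace :=
  Complex.continuous_re.comp ((continuous_subtype_val.matrix_elem 0 0))

theorem SU2.halfTrace_eq_of_isConj {g h : SU2} (hc : IsConj g h) :
    SU2.halfTrace g = SU2.halfTrace h := by
  obtain ⟨c, rfl⟩ := isConj_iff.1 hc
  have h1 : (c * g * c⁻¹).1.trace = g.1.trace := by
    change (c.1 * g.1 * (c⁻¹).1).trace = _
    rw [Matrix.mul_assoc, trace_mul_comm, Matrix.mul_assoc]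
    have : (c⁻¹).1 * c.1 = 1 := congrArg Subtype.val (inv_mul_cancel c)
    rw [this, Matrix.mul_one]
  rw [SU2.trace_eq, SU2.trace_eq] at h1
  have := mul_left_cancel₀ two_ne_zero h1
  exact_mod_cast this.symm

theorem SU2.halfTrace_inv (g : SU2) : SU2.halfTrace g⁻¹ = SU2.halfTrace g := by
  change (star (g.1) 0 0).re = _
  simp [SU2.halfTrace, Matrix.star_apply]

theorem halfTrace_diagSU2 (θ : ℝ) : SU2.halfTrace (diagSU2 θ) = Real.cos θ := by
  simp [SU2.halfTrace, diagSU2, Complex.exp_re]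

/-- A unit eigenvector is the first column of some c in SU(2). Conjugating by c makes the first
column (e^(iθ), 0), which determines the matrix. Hence the half trace classifies conjugacy classes.
-/
theorem SU2.isConj_diagSU2 (g : SU2) : IsConj g (diagSU2 (Real.arccos (SU2.halfTrace g))) := by
  set θ := Real.arccos (SU2.halfTrace g) with hθ
  have hcos : Real.cos θ = SU2.halfTrace g :=
    Real.cos_arccos (SU2.halfTrace_mem_Icc g).1 (SU2.halfTrace_mem_Icc g).2
  set ev := exp (I * θ) with hev
  -- The characteristic polynomial is X² - tX + 1 with t = 2 cos θ, whose roots are e^(iθ) and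
  -- e^(-iθ).
  have hdet : (g.1 - ev • (1 : Matrix (Fin 2) (Fin 2) ℂ)).det = 0 := by
    have hd : g.1 0 0 * g.1 1 1 - g.1 0 1 * g.1 1 0 = 1 := by
      rw [← det_fin_two]; exact g.2.2
    have ht : g.1 0 0 + g.1 1 1 = ev + exp (-(I * θ)) := by
      rw [← trace_fin_two, SU2.trace_eq, ← hcos, Complex.ofReal_cos, Complex.two_cos, hev]
      ring_nf
    have he : ev * exp (-(I * θ)) = 1 := by rw [hev, ← exp_add, add_neg_cancel, exp_zero]
    rw [det_fin_two]
    simp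
    linear_combination hd - ev * ht - he
  obtain ⟨v, hv0, hv⟩ := exists_mulVec_eq_zero_iff.2 hdet
  have hgv : g.1 *ᵥ v = ev • v := by
    rw [sub_mulVec, smul_mulVec, one_mulVec, sub_eq_zero] at hv
    exact hv
  set N : ℝ := Complex.normSq (v 0) + Complex.normSq (v 1) with hN
  have hNpos : 0 < N := by
    rcases eq_or_ne (v 0) 0 with h0 | h0
    · have h1 : v 1 ≠ 0 := fun h1 => hv0 (by ext i; fin_cases i <;> simp [h0, h1])
      have := Complex.normSq_pos.2 h1
      have := Complex.normSq_nonneg (v 0)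
      linarith
    · have := Complex.normSq_pos.2 h0
      have := Complex.normSq_nonneg (v 1)
      linarith
  set r : ℂ := (((Real.sqrt N)⁻¹ : ℝ) : ℂ) with hr
  have hrr : r * r * N = 1 := by
    rw [hr]
    have : (Real.sqrt N)⁻¹ * (Real.sqrt N)⁻¹ * N = 1 := by
      rw [← mul_inv, Real.mul_self_sqrt hNpos.le, inv_mul_cancel₀ hNpos.ne']
    exact_mod_cast this
  have hsr : star r = r := Complex.conj_ofReal _
  have hunit : star (r * v 0) * (r * v 0) + star (r * v 1) * (r * v 1) = 1 := by
    have e0 : star (v 0) * v 0 = (Complex.normSq (v 0) : ℂ) := Complex.normSq_eq_conj_mul_self.symm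
    have e1 : star (v 1) * v 1 = (Complex.normSq (v 1) : ℂ) := Complex.normSq_eq_conj_mul_self.symm
    rw [star_mul', star_mul', hsr]
    rw [hN] at hrr
    push_cast at hrr
    linear_combination hrr + r * r * e0 + r * r * e1
  set c := SU2.mk _ _ hunit with hc
  have hcol : c.1 *ᵥ Pi.single 0 1 = r • v := by
    rw [mulVec_single_one]
    ext i
    fin_cases i <;> simp [hc, SU2.mk, Matrix.col]
  have hD : (c⁻¹ * g * c).1 *ᵥ Pi.single 0 1 = ev • Pi.single 0 1 := by
    change ((c⁻¹).1 * g.1 * c.1) *ᵥ Pi.single 0 1 = _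
    rw [← mulVec_mulVec, hcol, mulVec_smul, ← mulVec_mulVec, hgv, mulVec_smul, smul_comm,
      ← mulVec_smul, ← hcol, mulVec_mulVec]
    have : (c⁻¹).1 * c.1 = 1 := congrArg Subtype.val (inv_mul_cancel c)
    rw [this, one_mulVec]
  have h00 : (c⁻¹ * g * c).1 0 0 = ev := by
    have := congrFun hD 0
    rw [mulVec_single_one] at this
    simpa [Matrix.col] using this
  have h10 : (c⁻¹ * g * c).1 1 0 = 0 := by
    have := congrFun hD 1
    rw [mulVec_single_one] at this
    simpa [Matrix.col] using this
  have hfin : c⁻¹ * g * c = diagSU2 θ := by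
    apply Subtype.ext
    ext i j
    fin_cases i <;> fin_cases j
    · exact h00
    · change (c⁻¹ * g * c).1 0 1 = 0
      rw [SU2.apply_zero_one, h10]; simp
    · exact h10
    · change (c⁻¹ * g * c).1 1 1 = exp (-(I * θ))
      rw [SU2.apply_one_one, h00, hev]
      change (starRingEnd ℂ) _ = _
      rw [← exp_conj]
      simp
  exact isConj_iff.2 ⟨c⁻¹, by rw [inv_inv]; exact hfin⟩

theorem SU2.eq_arccos_halfTrace {g : SU2} {θ : ℝ} (h0 : 0 ≤ θ) (h1 : θ ≤ Real.pi)
    (h : IsConj g (diagSU2 θ)) : Real.arccos (SU2.halfTrace g) = θ := by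
  rw [SU2.halfTrace_eq_of_isConj h, halfTrace_diagSU2, Real.arccos_cos h0 h1]

end SU2

/-! ### Symmetric powers: unitarity, irreducibility, characters -/

section SymPower

open Matrix

variable {d : ℕ}

/-- The vector of weighted monomials of degree `d` in two variables, at the point `z`. -/
noncomputable def monomialVec (d : ℕ) (z : Fin 2 → ℂ) : Fin (d + 1) → ℂ := fun l =>
  (Real.sqrt (d.choose l) : ℂ) * (z 0 ^ (l : ℕ) * z 1 ^ (d - l))

theorem sqrt_choose_ne_zero (l : Fin (d + 1)) : (Real.sqrt (d.choose l) : ℂ) ≠ 0 := by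
  have : (0 : ℝ) < d.choose l := by exact_mod_cast Nat.choose_pos (Nat.lt_succ_iff.1 l.2)
  exact Complex.ofReal_ne_zero.2 (Real.sqrt_pos.2 this).ne'

theorem sqrt_choose_mul_self (l : ℕ) :
    (Real.sqrt (d.choose l) : ℂ) * (Real.sqrt (d.choose l) : ℂ) = (d.choose l : ℂ) := by
  rw [← Complex.ofReal_mul, Real.mul_self_sqrt (Nat.cast_nonneg _)]
  simp

/-- At the points (x, 1) the pairing is a polynomial in x whose coefficients are nonzero multiples
of the entries of v. Monomial vectors therefore span, and matrix identities can be tested on them.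
-/
theorem eq_zero_of_dotProduct_monomialVec {v : Fin (d + 1) → ℂ}
    (h : ∀ z, v ⬝ᵥ monomialVec d z = 0) : v = 0 := by
  let p : Polynomial ℂ := ∑ l : Fin (d + 1),
    Polynomial.C (v l * (Real.sqrt (d.choose l) : ℂ)) * Polynomial.X ^ (l : ℕ)
  have hp : p = 0 := by
    refine Polynomial.funext fun x => ?_
    have := h ![x, 1]
    simp only [dotProduct, monomialVec, cons_val_zero, cons_val_one, one_pow, mul_one] at this
    simp only [p, Polynomial.eval_finsetSum, Polynomial.eval_mul, Polynomial.eval_C,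
      Polynomial.eval_pow, Polynomial.eval_X, Polynomial.eval_zero]
    rw [← this]
    exact Finset.sum_congr rfl fun l _ => by ring
  ext l
  have hl := congrArg (fun q => Polynomial.coeff q (l : ℕ)) hp
  simp only [p, Polynomial.finsetSum_coeff, Polynomial.coeff_C_mul, Polynomial.coeff_X_pow,
    Polynomial.coeff_zero] at hl
  rw [Finset.sum_eq_single l (fun b _ hb => by
    rw [if_neg fun h => hb (Fin.ext h.symm), mul_zero]) (by simp)] at hl
  rw [if_pos rfl, mul_one] at hl
  exact (mul_eq_zero.1 hl).resolve_right (sqrt_choose_ne_zero l)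

theorem matrix_ext_monomialVec {m : Type*} {A B : Matrix m (Fin (d + 1)) ℂ}
    (h : ∀ z, A *ᵥ monomialVec d z = B *ᵥ monomialVec d z) : A = B := by
  ext i j
  have : A i - B i = 0 := eq_zero_of_dotProduct_monomialVec fun z => by
    rw [sub_dotProduct, sub_eq_zero]
    exact congrFun (h z) i
  exact sub_eq_zero.1 (congrFun this j)

/-- The binomial theorem. The weights √(d choose l) are chosen to make this hold, and with it the
unitarity of the symmetric powers. -/
theorem star_monomialVec_dotProduct (z w : Fin 2 → ℂ) :
    star (monomialVec d z) ⬝ᵥ monomialVec d w = (star z ⬝ᵥ w) ^ d := by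
  have : star z ⬝ᵥ w = star (z 0) * w 0 + star (z 1) * w 1 := by
    simp [dotProduct, Fin.sum_univ_two]
  rw [this, add_pow, Finset.sum_range, dotProduct]
  refine Finset.sum_congr rfl fun l _ => ?_
  have hs : star (monomialVec d z) l =
      (Real.sqrt (d.choose l) : ℂ) * (star (z 0) ^ (l : ℕ) * star (z 1) ^ (d - l)) := by
    simp [monomialVec]
  rw [hs, ← sqrt_choose_mul_self, monomialVec, mul_pow, mul_pow]
  ring

/-- The coefficient of `x ^ l * y ^ (d - l)` in
`(A 0 0 * x + A 0 1 * y) ^ k * (A 1 0 * x + A 1 1 * y) ^ (d - k)`. -/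
noncomputable def binaryFormCoeff (d k l : ℕ) (A : Matrix (Fin 2) (Fin 2) ℂ) : ℂ :=
  ∑ i ∈ Finset.range (k + 1), ∑ j ∈ Finset.range (d - k + 1),
    if i + j = l then
      (A 0 0 ^ i * A 0 1 ^ (k - i) * k.choose i) *
        (A 1 0 ^ j * A 1 1 ^ (d - k - j) * (d - k).choose j)
    else 0

theorem sum_binaryFormCoeff {k : ℕ} (hk : k ≤ d) (A : Matrix (Fin 2) (Fin 2) ℂ) (x y : ℂ) :
    ∑ l : Fin (d + 1), binaryFormCoeff d k l A * (x ^ (l : ℕ) * y ^ (d - l)) =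
      (A 0 0 * x + A 0 1 * y) ^ k * (A 1 0 * x + A 1 1 * y) ^ (d - k) := by
  rw [add_pow, add_pow, Finset.sum_mul_sum,
    Fin.sum_univ_eq_sum_range fun l => binaryFormCoeff d k l A * (x ^ l * y ^ (d - l))]
  simp only [binaryFormCoeff, Finset.sum_mul]
  rw [Finset.sum_comm]
  refine Finset.sum_congr rfl fun i hi => ?_
  rw [Finset.sum_comm]
  refine Finset.sum_congr rfl fun j hj => ?_
  rw [Finset.mem_range] at hi hj
  rw [Finset.sum_eq_single (i + j) (fun b _ hb => by rw [if_neg hb.symm, zero_mul])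
    (fun h => absurd (Finset.mem_range.2 (by omega)) h), if_pos rfl,
    show d - (i + j) = (k - i) + (d - k - j) by omega]
  simp only [mul_pow, pow_add]
  ring

/-- The `d`-th symmetric power of a `2 × 2` matrix, in the basis of weighted monomials. -/
noncomputable def symMatrix (d : ℕ) (A : Matrix (Fin 2) (Fin 2) ℂ) : Matrix (Fin (d + 1)) (Fin (d + 1)) ℂ :=
  Matrix.of fun k l => (Real.sqrt (d.choose k) : ℂ) * binaryFormCoeff d k l A /
    (Real.sqrt (d.choose l) : ℂ)

/-- This property characterises `symMatrix`; multiplicativity, adjoints and diagonal matrices are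
all deduced from it, without the explicit coefficients. -/
theorem symMatrix_mulVec_monomialVec (A : Matrix (Fin 2) (Fin 2) ℂ) (z : Fin 2 → ℂ) :
    symMatrix d A *ᵥ monomialVec d z = monomialVec d (A *ᵥ z) := by
  ext k
  have h := sum_binaryFormCoeff (Nat.lt_succ_iff.1 k.2) A (z 0) (z 1)
  have e : ∀ i, (A *ᵥ z) i = A i 0 * z 0 + A i 1 * z 1 := fun i => by
    simp [mulVec, dotProduct, Fin.sum_univ_two]
  rw [monomialVec, e, e, ← h, mulVec, dotProduct, Finset.mul_sum]
  refine Finset.sum_congr rfl fun l _ => ?_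
  simp only [symMatrix, of_apply, monomialVec]
  have := sqrt_choose_ne_zero l
  field_simp

theorem symMatrix_one : symMatrix d 1 = 1 :=
  matrix_ext_monomialVec fun z => by rw [symMatrix_mulVec_monomialVec, one_mulVec, one_mulVec]

theorem symMatrix_mul (A B : Matrix (Fin 2) (Fin 2) ℂ) :
    symMatrix d (A * B) = symMatrix d A * symMatrix d B :=
  matrix_ext_monomialVec fun z => by
    rw [← mulVec_mulVec]
    simp only [symMatrix_mulVec_monomialVec]
    rw [mulVec_mulVec]

/-- Paired with monomial vectors at z and w, both sides give ⟨z, A*w⟩^d = ⟨Az, w⟩^d. -/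
theorem symMatrix_star (A : Matrix (Fin 2) (Fin 2) ℂ) :
    symMatrix d (star A) = star (symMatrix d A) := by
  refine matrix_ext_monomialVec fun w => ?_
  rw [← sub_eq_zero, ← star_eq_zero]
  refine eq_zero_of_dotProduct_monomialVec fun z => ?_
  rw [← star_inj, star_zero, ← star_dotProduct_star, star_star,
    dotProduct_sub, sub_eq_zero, symMatrix_mulVec_monomialVec, star_monomialVec_dotProduct,
    star_eq_conjTranspose (symMatrix d A), star_eq_conjTranspose A, dotProduct_mulVec,
    ← star_mulVec, dotProduct_mulVec (star (monomialVec d z)), ← star_mulVec,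
    symMatrix_mulVec_monomialVec, star_monomialVec_dotProduct]

theorem continuous_symMatrix : Continuous (symMatrix d) := by
  refine continuous_matrix fun k l => ?_
  simp only [symMatrix, of_apply, binaryFormCoeff]
  refine (continuous_const.mul ?_).div_const _
  refine continuous_finsetSum _ fun i _ => continuous_finsetSum _ fun j _ => ?_
  split_ifs
  · fun_prop
  · exact continuous_const

theorem symMatrix_diagonal (x y : ℂ) :
    symMatrix d !![x, 0; 0, y] = diagonal fun l : Fin (d + 1) => x ^ (l : ℕ) * y ^ (d - l) := by
  refine matrix_ext_monomialVec fun z => ?_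
  rw [symMatrix_mulVec_monomialVec]
  ext l
  rw [mulVec_diagonal]
  simp [monomialVec, mul_pow, mulVec, dotProduct, Fin.sum_univ_two]
  ring

theorem monomialVec_zero_one : monomialVec d ![0, 1] = Pi.single 0 1 := by
  ext l
  refine Fin.cases ?_ (fun l => ?_) l
  · simp [monomialVec]
  · simp [monomialVec]

theorem symMatrix_apply_zero (A : Matrix (Fin 2) (Fin 2) ℂ) (l : Fin (d + 1)) :
    symMatrix d A l 0 = (Real.sqrt (d.choose l) : ℂ) * (A 0 1 ^ (l : ℕ) * A 1 1 ^ (d - l)) := by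
  have h := congrFun (symMatrix_mulVec_monomialVec (d := d) A ![0, 1]) l
  rw [monomialVec_zero_one, mulVec_single_one] at h
  simpa [monomialVec, Matrix.col, mulVec, dotProduct, Fin.sum_univ_two] using h

/-- The symmetric power as a homomorphism from `SU(2)` to the unitary group. -/
noncomputable def symHom (d : ℕ) : SU2 →* Matrix.unitaryGroup (Fin (d + 1)) ℂ where
  toFun g := ⟨symMatrix d g.1, by
    rw [mem_unitaryGroup_iff', ← symMatrix_star, ← symMatrix_mul,
      mem_unitaryGroup_iff'.1 g.2.1, symMatrix_one]⟩
  map_one' := Subtype.ext symMatrix_one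
  map_mul' g h := Subtype.ext (symMatrix_mul g.1 h.1)

theorem continuous_symHom : Continuous (symHom d) :=
  (continuous_symMatrix.comp continuous_subtype_val).subtype_mk _

/-- A subspace invariant under a diagonal operator with distinct eigenvalues contains the
components of its vectors. -/
theorem single_mem_of_diagonal_invariant {n : Type*} [Fintype n] [DecidableEq n] {w : n → ℂ}
    (hw : Function.Injective w) (S : Submodule ℂ (n → ℂ))
    (hS : ∀ v ∈ S, (fun i => w i * v i) ∈ S) {v : n → ℂ} (hv : v ∈ S) (k : n) :
    Pi.single k (v k) ∈ S := by
  have hpow : ∀ j : ℕ, (fun i => w i ^ j * v i) ∈ S := fun j => by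
    induction j with
    | zero => simpa using hv
    | succ j ih =>
      convert hS _ ih using 1
      ext i
      ring
  -- The Lagrange polynomial equal to 1 at w k and 0 at the other eigenvalues, applied to the
  -- operator, is the projection to the k-th coordinate.
  set p := Lagrange.basis Finset.univ w k with hp
  have hmem : ∑ j ∈ Finset.range (p.natDegree + 1), p.coeff j • (fun i => w i ^ j * v i) ∈ S :=
    S.sum_mem fun j _ => S.smul_mem _ (hpow j)
  convert hmem using 1
  ext i
  have he : (∑ j ∈ Finset.range (p.natDegree + 1), p.coeff j • (fun i => w i ^ j * v i)) i =
      p.eval (w i) * v i := by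
    rw [Polynomial.eval_eq_sum_range, Finset.sum_apply, Finset.sum_mul]
    exact Finset.sum_congr rfl fun j _ => by simp [mul_assoc]
  rw [he]
  rcases eq_or_ne k i with rfl | hki
  · rw [Lagrange.eval_basis_self hw.injOn (Finset.mem_univ _)]
    simp
  · rw [hp, Lagrange.eval_basis_of_ne hki (Finset.mem_univ _)]
    simp [hki.symm]

/-- With x = exp(πi/(d + 1)), multiplying the weights by x^d turns them into the powers (x²)^l for l
≤ d, and x² is a primitive root of unity of order d + 1. -/
theorem weights_injective (d : ℕ) : Function.Injective fun l : Fin (d + 1) =>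
    exp (I * (Real.pi / (d + 1) : ℝ)) ^ (l : ℕ) *
      exp (-(I * (Real.pi / (d + 1) : ℝ))) ^ (d - l) := by
  set x := exp (I * (Real.pi / (d + 1) : ℝ)) with hx
  have hx0 : x ≠ 0 := exp_ne_zero _
  have hy : exp (-(I * (Real.pi / (d + 1) : ℝ))) = x⁻¹ := by rw [exp_neg]
  have hprim : IsPrimitiveRoot (x ^ 2) (d + 1) := by
    convert Complex.isPrimitiveRoot_exp (d + 1) (Nat.succ_ne_zero d) using 1
    rw [hx, ← exp_nat_mul]
    congr 1
    push_cast
    ring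
  intro k l hkl
  simp only [hy] at hkl
  have key : ∀ l : Fin (d + 1), x ^ (l : ℕ) * x⁻¹ ^ (d - l) * x ^ d = (x ^ 2) ^ (l : ℕ) := by
    intro l
    have hl : (l : ℕ) ≤ d := Nat.lt_succ_iff.1 l.2
    have : x ^ d = x ^ (d - l) * x ^ (l : ℕ) := by rw [← pow_add, Nat.sub_add_cancel hl]
    rw [this, inv_pow]
    have : x ^ (d - l) ≠ 0 := pow_ne_zero _ hx0
    field_simp
    ring
  have := congrArg (· * x ^ d) hkl
  simp only [key] at this
  exact Fin.ext (hprim.pow_inj k.2 l.2 this)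

/-- The rotation of the plane by an eighth of a turn. -/
noncomputable def rotationSU2 : SU2 :=
  SU2.mk (Real.sqrt 2)⁻¹ (Real.sqrt 2)⁻¹ (by
    have h : ((Real.sqrt 2 : ℝ) : ℂ) * (Real.sqrt 2 : ℝ) = 2 := by
      rw [← Complex.ofReal_mul, Real.mul_self_sqrt zero_le_two]; simp
    have h0 : ((Real.sqrt 2 : ℝ) : ℂ) ≠ 0 := by
      intro h0; simp [h0] at h
    simp only [star_inv₀]
    rw [show star ((Real.sqrt 2 : ℝ) : ℂ) = (Real.sqrt 2 : ℝ) from Complex.conj_ofReal _,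
      ← mul_inv, h]
    norm_num)

theorem rotationSU2_apply_ne_zero (i j : Fin 2) : rotationSU2.1 i j ≠ 0 := by
  fin_cases i <;> fin_cases j <;> simp [rotationSU2, SU2.mk]

/-- A torus element with distinct weights forces a nonzero invariant subspace to contain a basis
vector e_k. The rotation has no zero entry, so its symmetric power has nonzero entries in row 0 and
column 0, which leads from e_k to e_0 and then to every e_l. -/
theorem isIrreducible_symHom (d : ℕ) : Representation.IsIrreducible
    (((Matrix.toLinAlgEquiv' : Matrix (Fin (d + 1)) (Fin (d + 1)) ℂ ≃ₐ[ℂ] _) : _ →* _).comp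
        ((Matrix.unitaryGroup (Fin (d + 1)) ℂ).subtype.comp (symHom d)) :
      Representation ℂ SU2 (Fin (d + 1) → ℂ)) := by
  set ρ : Representation ℂ SU2 (Fin (d + 1) → ℂ) :=
    (((Matrix.toLinAlgEquiv' : Matrix (Fin (d + 1)) (Fin (d + 1)) ℂ ≃ₐ[ℂ] _) : _ →* _).comp
        ((Matrix.unitaryGroup (Fin (d + 1)) ℂ).subtype.comp (symHom d))) with hρ
  have hρa : ∀ g v, ρ g v = symMatrix d g.1 *ᵥ v := fun g v => rfl
  have key : ∀ S : Subrepresentation ρ, S ≠ ⊥ → S = ⊤ := by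
    intro S hS
    have hinv : ∀ (g : SU2) v, v ∈ S.toSubmodule → symMatrix d g.1 *ᵥ v ∈ S.toSubmodule :=
      fun g v hv => S.apply_mem_toSubmodule g hv
    have hproj : ∀ v ∈ S.toSubmodule, ∀ k, Pi.single k (v k) ∈ S.toSubmodule := by
      intro v hv k
      refine single_mem_of_diagonal_invariant (weights_injective d) S.toSubmodule ?_ hv k
      intro u hu
      have := hinv (diagSU2 (Real.pi / (d + 1))) u hu
      rw [diagSU2, symMatrix_diagonal] at this
      convert this using 1
      ext i
      rw [mulVec_diagonal]
    have hsingle : ∀ v ∈ S.toSubmodule, ∀ k, v k ≠ 0 →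
        (Pi.single k 1 : Fin (d + 1) → ℂ) ∈ S.toSubmodule := by
      intro v hv k hk
      have := S.toSubmodule.smul_mem (v k)⁻¹ (hproj v hv k)
      rwa [← Pi.single_smul, smul_eq_mul, inv_mul_cancel₀ hk] at this
    have hcol : ∀ k l, (Pi.single k 1 : Fin (d + 1) → ℂ) ∈ S.toSubmodule →
        symMatrix d rotationSU2.1 l k ≠ 0 →
        (Pi.single l 1 : Fin (d + 1) → ℂ) ∈ S.toSubmodule := by
      intro k l hk hne
      have := hinv rotationSU2 _ hk
      rw [mulVec_single_one] at this
      exact hsingle _ this l hne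
    have hne : S.toSubmodule ≠ ⊥ := fun h => hS (Subrepresentation.toSubmodule_injective h)
    obtain ⟨v, hv, hv0⟩ := Submodule.exists_mem_ne_zero_of_ne_bot hne
    obtain ⟨k, hk⟩ := Function.ne_iff.1 hv0
    have h0 : (Pi.single 0 1 : Fin (d + 1) → ℂ) ∈ S.toSubmodule := by
      refine hcol k 0 (hsingle v hv k hk) ?_
      -- Only column 0 has a simple closed form, so row 0 is read off from the adjoint.
      have : symMatrix d rotationSU2.1 0 k = star (symMatrix d (star rotationSU2.1) k 0) := by
        rw [symMatrix_star, Matrix.star_apply, star_star]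
      rw [this, symMatrix_apply_zero, star_ne_zero]
      refine mul_ne_zero (sqrt_choose_ne_zero k) (mul_ne_zero (pow_ne_zero _ ?_) (pow_ne_zero _ ?_))
      · rw [Matrix.star_apply, star_ne_zero]; exact rotationSU2_apply_ne_zero _ _
      · rw [Matrix.star_apply, star_ne_zero]; exact rotationSU2_apply_ne_zero _ _
    have hall : ∀ l, (Pi.single l 1 : Fin (d + 1) → ℂ) ∈ S.toSubmodule := by
      intro l
      refine hcol 0 l h0 ?_
      rw [symMatrix_apply_zero]
      exact mul_ne_zero (sqrt_choose_ne_zero l)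
        (mul_ne_zero (pow_ne_zero _ (rotationSU2_apply_ne_zero _ _))
          (pow_ne_zero _ (rotationSU2_apply_ne_zero _ _)))
    refine Subrepresentation.toSubmodule_injective ?_
    change S.toSubmodule = ⊤
    refine Submodule.eq_top_iff'.2 fun v => ?_
    rw [pi_eq_sum_univ' v]
    exact S.toSubmodule.sum_mem fun i _ => S.toSubmodule.smul_mem _ (hall i)
  have hnt : (⊥ : Subrepresentation ρ) ≠ ⊤ := by
    intro h
    have h1 : (⊥ : Submodule ℂ (Fin (d + 1) → ℂ)) = ⊤ :=
      congrArg Subrepresentation.toSubmodule h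
    exact bot_ne_top h1
  exact
    { exists_pair_ne := ⟨_, _, hnt⟩
      eq_bot_or_eq_top := fun S => or_iff_not_imp_left.2 (key S) }

/-- The irreducible representation of `SU(2)` on binary forms of degree `d`. -/
noncomputable def symRep (d : ℕ) : IrredUnitaryRep SU2 where
  dim := d + 1
  hom := symHom d
  continuous_hom := continuous_symHom
  irreducible := isIrreducible_symHom d

/-- The character of the irreducible representation of `SU(2)` of degree `d + 1`. -/
noncomputable def symChar (d : ℕ) (g : SU2) : ℂ := (symMatrix d g.1).trace

theorem character_symRep (d : ℕ) (g : SU2) : (symRep d).rep.character g = symChar d g := by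
  change LinearMap.trace ℂ _ (Matrix.toLin' (symMatrix d g.1)) = _
  rw [Matrix.trace_toLin'_eq]
  rfl

theorem symChar_diagSU2 (d : ℕ) (θ : ℝ) : symChar d (diagSU2 θ) =
    ∑ k ∈ Finset.range (d + 1), exp (I * θ) ^ k * exp (-(I * θ)) ^ (d - k) := by
  rw [symChar, diagSU2, symMatrix_diagonal, trace_diagonal,
    Fin.sum_univ_eq_sum_range fun k => exp (I * θ) ^ k * exp (-(I * θ)) ^ (d - k)]

theorem symChar_eq_of_isConj {g h : SU2} (hc : IsConj g h) (d : ℕ) :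
    symChar d g = symChar d h := by
  obtain ⟨c, rfl⟩ := isConj_iff.1 hc
  change _ = (symMatrix d (c.1 * g.1 * (c⁻¹).1)).trace
  rw [symMatrix_mul, trace_mul_comm, ← symMatrix_mul, ← Matrix.mul_assoc]
  have : (c⁻¹).1 * c.1 = 1 := congrArg Subtype.val (inv_mul_cancel c)
  rw [this, Matrix.one_mul, symChar]

theorem symChar_eq_of_halfTrace_eq {g h : SU2} (he : SU2.halfTrace g = SU2.halfTrace h) (d : ℕ) :
    symChar d g = symChar d h := by
  rw [symChar_eq_of_isConj (SU2.isConj_diagSU2 g), he, symChar_eq_of_isConj (SU2.isConj_diagSU2 h)]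

theorem continuous_symChar (d : ℕ) : Continuous (symChar d) :=
  (continuous_symMatrix.comp continuous_subtype_val).matrix_trace

theorem symChar_zero (g : SU2) : symChar 0 g = 1 := by
  rw [symChar_eq_of_isConj (SU2.isConj_diagSU2 g), symChar_diagSU2]
  simp

theorem symChar_one (g : SU2) : symChar 1 g = 2 * (SU2.halfTrace g : ℂ) := by
  have hg := SU2.isConj_diagSU2 g
  set θ := Real.arccos (SU2.halfTrace g)
  rw [symChar_eq_of_isConj hg,
    SU2.halfTrace_eq_of_isConj hg, symChar_diagSU2, halfTrace_diagSU2,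
    Complex.ofReal_cos, Complex.two_cos, Finset.sum_range_succ, Finset.sum_range_one]
  simp
  ring_nf

/-- The Clebsch-Gordan rule for the tensor product with the standard representation, equivalently
the Chebyshev recursion. -/
theorem two_mul_halfTrace_mul_symChar_succ (d : ℕ) (g : SU2) :
    2 * (SU2.halfTrace g : ℂ) * symChar (d + 1) g = symChar (d + 2) g + symChar d g := by
  have hg := SU2.isConj_diagSU2 g
  set θ := Real.arccos (SU2.halfTrace g)
  rw [symChar_eq_of_isConj hg, symChar_eq_of_isConj hg, symChar_eq_of_isConj hg,
    SU2.halfTrace_eq_of_isConj hg, symChar_diagSU2, symChar_diagSU2, symChar_diagSU2,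
    halfTrace_diagSU2]
  have hxy : exp (I * θ) * exp (-(I * θ)) = 1 := by rw [← exp_add, add_neg_cancel, exp_zero]
  have hc : 2 * ((Real.cos θ : ℝ) : ℂ) = exp (I * θ) + exp (-(I * θ)) := by
    rw [Complex.ofReal_cos, Complex.two_cos]; ring_nf
  rw [hc]
  set x := exp (I * θ)
  set y := exp (-(I * θ))
  have h1 := geom_sum₂_succ_eq x y (n := d + 1)
  have h2 := geom_sum₂_succ_eq x y (n := d + 2)
  simp only [Nat.add_sub_cancel, show d + 2 - 1 = d + 1 from rfl] at h1 h2
  rw [show d + 2 = d + 1 + 1 from rfl] at *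
  rw [h2]
  linear_combination x * h1 + (∑ k ∈ Finset.range (d + 1), x ^ k * y ^ (d - k)) * hxy

end SymPower

/-! ### Schur orthogonality for compact groups -/

section Orthogonality

open Matrix MeasureTheory

variable {G : Type*} [Group G] [TopologicalSpace G]

namespace IrredUnitaryRep

theorem rep_apply (ρ : IrredUnitaryRep G) (g : G) (v : Fin ρ.dim → ℂ) :
    ρ.rep g v = (ρ.hom g).1 *ᵥ v := rfl

theorem character_eq_trace (ρ : IrredUnitaryRep G) (g : G) :
    ρ.rep.character g = (ρ.hom g).1.trace := by
  change LinearMap.trace ℂ _ (Matrix.toLin' (ρ.hom g).1) = _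
  rw [Matrix.trace_toLin'_eq]

theorem continuous_apply (ρ : IrredUnitaryRep G) (i j : Fin ρ.dim) :
    Continuous fun g => (ρ.hom g).1 i j :=
  (continuous_subtype_val.comp ρ.continuous_hom).matrix_elem i j

theorem continuous_character (ρ : IrredUnitaryRep G) : Continuous ρ.rep.character := by
  have : ρ.rep.character = fun g => (ρ.hom g).1.trace := funext ρ.character_eq_trace
  rw [this]
  exact (continuous_subtype_val.comp ρ.continuous_hom).matrix_trace

theorem hom_mul_apply (ρ : IrredUnitaryRep G) (g h : G) (i j : Fin ρ.dim) :
    (ρ.hom (g * h)).1 i j = ∑ m, (ρ.hom g).1 i m * (ρ.hom h).1 m j := by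
  rw [map_mul]
  exact Matrix.mul_apply

theorem isIrreducible_rep (ρ : IrredUnitaryRep G) : ρ.rep.IsIrreducible := ρ.irreducible

/-- Schur's lemma in matrix form. -/
theorem matrix_eq_zero_of_intertwining {ρ σ : IrredUnitaryRep G}
    (h : IsEmpty (ρ.rep.Equiv σ.rep)) {A : Matrix (Fin ρ.dim) (Fin σ.dim) ℂ}
    (hA : ∀ g, (ρ.hom g).1 * A = A * (σ.hom g).1) : A = 0 := by
  have h' : IsEmpty (σ.rep.Equiv ρ.rep) := ⟨fun e => h.false e.symm⟩
  have := ρ.isIrreducible_rep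
  have := σ.isIrreducible_rep
  let f : σ.rep.IntertwiningMap ρ.rep := ⟨Matrix.toLin' A, fun g => by
    refine LinearMap.ext fun v => ?_
    rw [LinearMap.comp_apply, LinearMap.comp_apply, rep_apply, rep_apply, Matrix.toLin'_apply, Matrix.toLin'_apply, mulVec_mulVec,
      mulVec_mulVec, hA]⟩
  have hf : f = 0 := Subsingleton.elim _ _
  have : Matrix.toLin' A = 0 := congrArg Representation.IntertwiningMap.toLinearMap hf
  simpa using this

variable [IsTopologicalGroup G] [CompactSpace G] [MeasurableSpace G] [BorelSpace G]

/-- Orthogonality of the matrix coefficients of inequivalent irreducible representations. -/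
theorem integral_matrixCoeff_mul_eq_zero {ρ σ : IrredUnitaryRep G}
    (h : IsEmpty (ρ.rep.Equiv σ.rep)) (μ : Measure G) [IsFiniteMeasure μ]
    [μ.IsMulLeftInvariant] (i j : Fin ρ.dim) (k l : Fin σ.dim) :
    ∫ g, (ρ.hom g).1 i j * (σ.hom g⁻¹).1 k l ∂μ = 0 := by
  have hint : ∀ (h : G) (i j : Fin ρ.dim) (k l : Fin σ.dim),
      Integrable (fun g => (ρ.hom g).1 i j * (σ.hom (g⁻¹ * h)).1 k l) μ := fun h i j k l => by
    have hc : Continuous (fun g => (ρ.hom g).1 i j * (σ.hom (g⁻¹ * h)).1 k l) :=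
      (ρ.continuous_apply i j).mul ((σ.continuous_apply k l).comp (by fun_prop))
    exact hc.integrable_of_hasCompactSupport (HasCompactSupport.of_compactSpace _)
  -- This is the average of ρ(g) E σ(g⁻¹) for the matrix unit E at (j, k). Left invariance of μ
  -- makes it an intertwiner.
  let A : Matrix (Fin ρ.dim) (Fin σ.dim) ℂ :=
    Matrix.of fun i l => ∫ g, (ρ.hom g).1 i j * (σ.hom g⁻¹).1 k l ∂μ
  have hA : A = 0 := by
    refine matrix_eq_zero_of_intertwining h fun x => ?_
    ext i l
    rw [Matrix.mul_apply, Matrix.mul_apply]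
    have e1 : ∑ m, (ρ.hom x).1 i m * A m l =
        ∫ g, (ρ.hom (x * g)).1 i j * (σ.hom g⁻¹).1 k l ∂μ := by
      simp only [A, of_apply, ← integral_const_mul]
      rw [← integral_finsetSum _ fun m _ => by
        simpa using (hint 1 m j k l).const_mul ((ρ.hom x).1 i m)]
      congr 1
      ext g
      rw [hom_mul_apply, Finset.sum_mul]
      exact Finset.sum_congr rfl fun m _ => by ring
    have e2 : ∑ m, A i m * (σ.hom x).1 m l =
        ∫ g, (ρ.hom g).1 i j * (σ.hom (g⁻¹ * x)).1 k l ∂μ := by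
      simp only [A, of_apply, ← integral_mul_const]
      rw [← integral_finsetSum _ fun m _ => by
        simpa using (hint 1 i j k m).mul_const ((σ.hom x).1 m l)]
      congr 1
      ext g
      rw [hom_mul_apply, Finset.mul_sum]
      exact Finset.sum_congr rfl fun m _ => by ring
    rw [e1, e2, ← integral_mul_left_eq_self
      (fun g => (ρ.hom g).1 i j * (σ.hom (g⁻¹ * x)).1 k l) x]
    congr 1
    ext g
    rw [_root_.mul_inv_rev, inv_mul_cancel_right]
  exact congrFun (congrFun hA i) l

/-- Orthogonality of the characters of inequivalent irreducible representations. -/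
theorem integral_character_mul_eq_zero {ρ σ : IrredUnitaryRep G}
    (h : IsEmpty (ρ.rep.Equiv σ.rep)) (μ : Measure G) [IsFiniteMeasure μ]
    [μ.IsMulLeftInvariant] :
    ∫ g, ρ.rep.character g * σ.rep.character g⁻¹ ∂μ = 0 := by
  have hint : ∀ (i j : Fin ρ.dim) (k l : Fin σ.dim),
      Integrable (fun g => (ρ.hom g).1 i j * (σ.hom g⁻¹).1 k l) μ := fun i j k l => by
    have hc : Continuous (fun g => (ρ.hom g).1 i j * (σ.hom g⁻¹).1 k l) :=
      (ρ.continuous_apply i j).mul ((σ.continuous_apply k l).comp (by fun_prop))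
    exact hc.integrable_of_hasCompactSupport (HasCompactSupport.of_compactSpace _)
  simp only [character_eq_trace, Matrix.trace, Matrix.diag_apply, Finset.sum_mul_sum]
  rw [integral_finsetSum _ fun i _ => integrable_finsetSum _ fun k _ => hint i i k k]
  refine Finset.sum_eq_zero fun i _ => ?_
  rw [integral_finsetSum _ fun k _ => hint i i k k]
  exact Finset.sum_eq_zero fun k _ => integral_matrixCoeff_mul_eq_zero h μ i i k k

end IrredUnitaryRep

end Orthogonality

/-! ### Every irreducible representation is a symmetric power -/

section Completeness

open MeasureTheory

theorem IrredUnitaryRep.dim_pos {G : Type*} [Group G] [TopologicalSpace G]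
    (ρ : IrredUnitaryRep G) : 0 < ρ.dim := by
  rcases Nat.eq_zero_or_pos ρ.dim with h | h
  · have hS : Subsingleton (Fin ρ.dim → ℂ) := by rw [h]; infer_instance
    obtain ⟨S, T, hne⟩ := ρ.isIrreducible_rep.exists_pair_ne
    exact absurd (Subrepresentation.toSubmodule_injective (Subsingleton.elim _ _)) hne
  · exact h

theorem IrredUnitaryRep.character_eq_of_isConj {G : Type*} [Group G] [TopologicalSpace G]
    (ρ : IrredUnitaryRep G) {g h : G} (hc : IsConj g h) :
    ρ.rep.character g = ρ.rep.character h := by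
  obtain ⟨c, rfl⟩ := isConj_iff.1 hc
  exact (Representation.char_conj ρ.rep g c).symm

theorem continuous_diagSU2 : Continuous diagSU2 := by
  refine Continuous.subtype_mk (continuous_matrix fun i j => ?_) _
  fin_cases i <;> fin_cases j <;> simp <;> fun_prop

/-- A continuous class function on `SU(2)` orthogonal to all `symChar d` has zero real part. -/
theorem re_eq_zero_of_integral_mul_symChar_eq_zero [MeasurableSpace SU2] [BorelSpace SU2]
    (μ : Measure SU2) [IsFiniteMeasure μ] [μ.IsOpenPosMeasure] {χ : SU2 → ℂ}
    (hχ : Continuous χ) (hcl : ∀ g h, IsConj g h → χ g = χ h)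
    (horth : ∀ d, ∫ g, χ g * symChar d g ∂μ = 0) (g : SU2) : (χ g).re = 0 := by
  have ht : Continuous fun g => (SU2.halfTrace g : ℂ) :=
    Complex.continuous_ofReal.comp SU2.continuous_halfTrace
  have hI : ∀ {f : SU2 → ℂ}, Continuous f → Integrable f μ := fun hf =>
    hf.integrable_of_hasCompactSupport (HasCompactSupport.of_compactSpace _)
  have hIr : ∀ {f : SU2 → ℝ}, Continuous f → Integrable f μ := fun hf =>
    hf.integrable_of_hasCompactSupport (HasCompactSupport.of_compactSpace _)
  -- Multiplication by the half trace sends a symmetric power character to a combination of its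
  -- neighbours, so orthogonality survives all powers of the half trace.
  have hmon : ∀ k d, ∫ g, χ g * (SU2.halfTrace g : ℂ) ^ k * symChar d g ∂μ = 0 := by
    intro k
    induction k with
    | zero => simpa using horth
    | succ k ih =>
      have hi : ∀ d, Integrable (fun g => χ g * (SU2.halfTrace g : ℂ) ^ k * symChar d g) μ :=
        fun d => hI ((hχ.mul (ht.pow k)).mul (continuous_symChar d))
      intro d
      rcases d with _ | d
      · have e : (fun g => χ g * (SU2.halfTrace g : ℂ) ^ (k + 1) * symChar 0 g) =
            fun g => (1 / 2) * (χ g * (SU2.halfTrace g : ℂ) ^ k * symChar 1 g) := by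
          ext g
          rw [symChar_one, symChar_zero]
          ring
        rw [e, integral_const_mul, ih, mul_zero]
      · have e : (fun g => χ g * (SU2.halfTrace g : ℂ) ^ (k + 1) * symChar (d + 1) g) =
            fun g => (1 / 2) * (χ g * (SU2.halfTrace g : ℂ) ^ k * symChar (d + 2) g +
              χ g * (SU2.halfTrace g : ℂ) ^ k * symChar d g) := by
          ext g
          linear_combination (1 / 2) * (χ g * (SU2.halfTrace g : ℂ) ^ k) *
            two_mul_halfTrace_mul_symChar_succ d g
        rw [e, integral_const_mul, integral_add (hi _) (hi _), ih, ih, add_zero, mul_zero]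
  have hpoly : ∀ p : Polynomial ℝ, ∫ g, (χ g).re * p.eval (SU2.halfTrace g) ∂μ = 0 := by
    intro p
    have h1 : ∫ g, χ g * ((p.eval (SU2.halfTrace g) : ℝ) : ℂ) ∂μ = 0 := by
      have e : (fun g => χ g * ((p.eval (SU2.halfTrace g) : ℝ) : ℂ)) = fun g =>
          ∑ k ∈ Finset.range (p.natDegree + 1),
            (p.coeff k : ℂ) * (χ g * (SU2.halfTrace g : ℂ) ^ k * symChar 0 g) := by
        ext g
        rw [Polynomial.eval_eq_sum_range, symChar_zero]
        push_cast
        rw [Finset.mul_sum]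
        exact Finset.sum_congr rfl fun k _ => by ring
      have hi : ∀ k, Integrable (fun g => χ g * (SU2.halfTrace g : ℂ) ^ k * symChar 0 g) μ :=
        fun k => hI ((hχ.mul (ht.pow k)).mul (continuous_symChar 0))
      rw [e, integral_finsetSum _ fun k _ => (hi k).const_mul _]
      refine Finset.sum_eq_zero fun k _ => ?_
      rw [integral_const_mul, hmon, mul_zero]
    have hc : Continuous fun g => χ g * ((p.eval (SU2.halfTrace g) : ℝ) : ℂ) :=
      hχ.mul (Complex.continuous_ofReal.comp (p.continuous.comp SU2.continuous_halfTrace))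
    have h2 := Complex.reCLM.integral_comp_comm (hI hc)
    rw [h1] at h2
    simpa using h2
  set C : ℝ := ∫ g, |(χ g).re| ∂μ with hC
  have hC0 : 0 ≤ C := integral_nonneg fun _ => abs_nonneg _
  have hre : Continuous fun g => (χ g).re := Complex.continuous_re.comp hχ
  have hsq : ∀ ε > 0, ∫ g, (χ g).re * (χ g).re ∂μ ≤ ε * C := by
    intro ε hε
    -- As a class function, χ depends on the half trace x alone, through the representative with
    -- angle arccos x. Weierstrass approximation applies on [-1, 1].
    have hf : ContinuousOn (fun x : ℝ => (χ (diagSU2 (Real.arccos x))).re) (Set.Icc (-1) 1) :=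
      (hre.comp (continuous_diagSU2.comp Real.continuous_arccos)).continuousOn
    obtain ⟨p, hp⟩ := exists_polynomial_near_of_continuousOn _ _ _ hf ε hε
    have hb : ∀ g, (χ g).re * ((χ g).re - p.eval (SU2.halfTrace g)) ≤ ε * |(χ g).re| := by
      intro g
      have h := hp _ (SU2.halfTrace_mem_Icc g)
      rw [← hcl _ _ (SU2.isConj_diagSU2 g), abs_sub_comm] at h
      calc _ ≤ |(χ g).re * ((χ g).re - p.eval (SU2.halfTrace g))| := le_abs_self _
        _ = |(χ g).re - p.eval (SU2.halfTrace g)| * |(χ g).re| := by rw [abs_mul, mul_comm]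
        _ ≤ _ := mul_le_mul_of_nonneg_right h.le (abs_nonneg _)
    have hpc : Continuous fun g => p.eval (SU2.halfTrace g) :=
      p.continuous.comp SU2.continuous_halfTrace
    have hi1 : Integrable (fun g => (χ g).re * (χ g).re) μ := hIr (hre.mul hre)
    have hi2 : Integrable (fun g => (χ g).re * p.eval (SU2.halfTrace g)) μ :=
      hIr (hre.mul hpc)
    calc ∫ g, (χ g).re * (χ g).re ∂μ
        = ∫ g, (χ g).re * ((χ g).re - p.eval (SU2.halfTrace g)) ∂μ := by
          simp_rw [mul_sub]
          rw [integral_sub hi1 hi2, hpoly, sub_zero]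
      _ ≤ ∫ g, ε * |(χ g).re| ∂μ :=
          integral_mono (hIr (hre.mul (hre.sub hpc))) (hIr (continuous_const.mul hre.abs)) hb
      _ = ε * C := integral_const_mul _ _
  by_contra hg
  have hpos : 0 < ∫ g, (χ g).re * (χ g).re ∂μ :=
    (hre.mul hre).integral_pos_of_hasCompactSupport_nonneg_nonzero
      (HasCompactSupport.of_compactSpace _) (fun g => mul_self_nonneg _) (mul_self_ne_zero.2 hg)
  -- With I the integral of the square and ε = I/(2(C + 1)), the bound εC is strictly below I.
  have := hsq ((∫ g, (χ g).re * (χ g).re ∂μ) / (2 * (C + 1))) (by positivity)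
  have h2 : (∫ g, (χ g).re * (χ g).re ∂μ) / (2 * (C + 1)) * C <
      ∫ g, (χ g).re * (χ g).re ∂μ := by
    rw [div_mul_eq_mul_div, div_lt_iff₀ (by positivity)]
    nlinarith
  linarith

/-- Every irreducible unitary representation of `SU(2)` is a symmetric power of the standard
one. -/
theorem exists_equiv_symRep (ρ : IrredUnitaryRep SU2) :
    ∃ d, Nonempty (ρ.rep.Equiv (symRep d).rep) := by
  by_contra! hne
  let _ : MeasurableSpace SU2 := borel SU2
  have : BorelSpace SU2 := ⟨rfl⟩
  have horth : ∀ d, ∫ g, ρ.rep.character g * symChar d g ∂Measure.haar = 0 := by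
    intro d
    have := IrredUnitaryRep.integral_character_mul_eq_zero
      (hne d) (Measure.haar : Measure SU2)
    simp only [character_symRep] at this
    -- Orthogonality involves the second character at g⁻¹, which has the same half trace as g.
    simpa only [symChar_eq_of_halfTrace_eq (SU2.halfTrace_inv _)] using this
  have h := re_eq_zero_of_integral_mul_symChar_eq_zero Measure.haar ρ.continuous_character
    (fun _ _ => ρ.character_eq_of_isConj) horth 1
  rw [IrredUnitaryRep.character_eq_trace, map_one] at h
  have h1 : (Matrix.trace (1 : Matrix (Fin ρ.dim) (Fin ρ.dim) ℂ)).re = 0 := h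
  rw [Matrix.trace_one, Fintype.card_fin] at h1
  have := ρ.dim_pos
  simp at h1
  omega

end Completeness

/-! ### The Witten series of SU(2) as a Dirichlet series -/

section UnitaryDualSU2

/-- The weights form a geometric sum, equal to (x^(d+1) - y^(d+1))/(x - y) with x, y = e^(±iθ). At
the endpoints x = y and all d + 1 terms coincide. -/
theorem symChar_diagSU2_eq_sinRatio {θ : ℝ} (h0 : 0 ≤ θ) (h1 : θ ≤ Real.pi) (d : ℕ) :
    symChar d (diagSU2 θ) = ((d + 1 : ℕ) : ℂ) * (sinRatio (d + 1) θ : ℂ) := by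
  rw [symChar_diagSU2]
  rcases h0.eq_or_lt with rfl | h0
  · simp [sinRatio]
  rcases h1.eq_or_lt with rfl | h1
  · have e1 : exp (I * Real.pi) = -1 := by rw [mul_comm, exp_pi_mul_I]
    have e2 : exp (-(I * Real.pi)) = -1 := by rw [exp_neg, e1]; norm_num
    rw [e1, e2, Finset.sum_congr rfl (g := fun _ => (-1 : ℂ) ^ d) fun k hk => by
      rw [← pow_add, Nat.add_sub_cancel' (Nat.lt_succ_iff.1 (Finset.mem_range.1 hk))]]
    rw [sinRatio, if_neg Real.pi_ne_zero, if_pos rfl, Finset.sum_const, Finset.card_range,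
      nsmul_eq_mul, pow_add, pow_add]
    push_cast
    ring
  · have hs : (Real.sin θ : ℂ) ≠ 0 :=
      Complex.ofReal_ne_zero.2 (Real.sin_pos_of_pos_of_lt_pi h0 h1).ne'
    rw [sinRatio, if_neg h0.ne', if_neg h1.ne]
    have hg := (Commute.all (exp (I * θ)) (exp (-(I * θ)))).geom_sum₂_mul (d + 1)
    rw [Nat.add_sub_cancel, ← exp_nat_mul, ← exp_nat_mul] at hg
    have e : ∀ x : ℂ, exp (I * x) - exp (-(I * x)) = 2 * I * Complex.sin x := fun x => by
      rw [Complex.sin, mul_comm I x, ← neg_mul]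
      linear_combination (exp (x * I) - exp (-x * I)) * I_mul_I
    rw [e θ, show ((d + 1 : ℕ) : ℂ) * (I * θ) = I * ((d + 1 : ℕ) * θ) by ring,
      show ((d + 1 : ℕ) : ℂ) * -(I * θ) = -(I * ((d + 1 : ℕ) * θ)) by ring, e] at hg
    have hd : ((d + 1 : ℕ) : ℂ) ≠ 0 := Nat.cast_ne_zero.2 (Nat.succ_ne_zero d)
    push_cast at hs hg hd ⊢
    field_simp
    refine mul_left_cancel₀ (mul_ne_zero two_ne_zero I_ne_zero) ?_
    rw [mul_comm (θ : ℂ) ((d : ℂ) + 1)]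
    linear_combination hg

/-- The class of the representation of `SU(2)` of degree `n`. -/
noncomputable def symClass (n : ℕ+) : UnitaryDual SU2 :=
  Quotient.mk _ (symRep n.natPred)

theorem deg_symClass (n : ℕ+) : (symClass n).deg = n :=
  n.natPred_add_one

theorem trace_symClass (n : ℕ+) (g : SU2) : (symClass n).trace g = symChar n.natPred g :=
  character_symRep _ g

/-- The unitary dual of `SU(2)` is in bijection with the positive integers, by the degree. -/
theorem bijective_symClass : Function.Bijective symClass := by
  constructor
  · intro m n h
    have := congrArg UnitaryDual.deg h
    rw [deg_symClass, deg_symClass] at this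
    exact PNat.coe_injective this
  · intro x
    induction x using Quotient.inductionOn with
    | h ρ =>
      obtain ⟨d, hd⟩ := exists_equiv_symRep ρ
      refine ⟨d.succPNat, Quotient.sound ?_⟩
      rw [Nat.natPred_succPNat]
      exact Setoid.symm hd

theorem wittenTerm_symClass {g : SU2} {θ : ℝ} (h0 : 0 ≤ θ) (h1 : θ ≤ Real.pi)
    (hg : IsConj g (diagSU2 θ)) (s : ℂ) (n : ℕ+) :
    wittenTerm s g (symClass n) = (sinRatio n θ : ℂ) * (n : ℂ) ^ (-s) := by
  have hn : ((n : ℕ) : ℂ) ≠ 0 := Nat.cast_ne_zero.2 n.ne_zero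
  rw [wittenTerm, deg_symClass, trace_symClass, symChar_eq_of_isConj hg,
    symChar_diagSU2_eq_sinRatio h0 h1, n.natPred_add_one, mul_div_cancel_left₀ _ hn]

theorem hasSum_wittenTerm {g : SU2} {θ : ℝ} (h0 : 0 ≤ θ) (h1 : θ ≤ Real.pi)
    (hg : IsConj g (diagSU2 θ)) {s : ℂ} (hs : 1 < s.re) :
    HasSum (wittenTerm s g) (sinRatioLSeries θ s) := by
  rw [← (Equiv.ofBijective _ bijective_symClass).hasSum_iff]
  exact (hasSum_sinRatioLSeries h0 h1 hs).congr_fun fun n => wittenTerm_symClass h0 h1 hg s n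

theorem wittenL_eq {g : SU2} {θ : ℝ} (h0 : 0 ≤ θ) (h1 : θ ≤ Real.pi)
    (hg : IsConj g (diagSU2 θ)) {s : ℂ} (hs : 1 < s.re) :
    wittenL s g = sinRatioLSeries θ s :=
  (hasSum_wittenTerm h0 h1 hg hs).tsum_eq

end UnitaryDualSU2

theorem theorem1 (g : SU2) :
    ∃ F : ℂ → ℂ,
      IsMeromorphicContinuation (fun s => wittenL s g) {s : ℂ | 1 < s.re} F ∧
      (∀ m : ℕ, 0 < m → Even m → HasRegularValueAt F 0 (-(m : ℂ))) ∧
      ∀ θ : ℝ, 0 ≤ θ → θ ≤ Real.pi → IsConj g (diagSU2 θ) →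
        (∀ s : ℂ, 1 < s.re →
          Summable (wittenTerm s g) ∧
          HasSum (fun n : ℕ+ => (sinRatio n θ : ℂ) * (n : ℂ) ^ (-s)) (wittenL s g)) ∧
        (AnalyticAt ℂ F (-2) ∧ analyticOrderAt F (-2) = 1) ∧
        (θ = 0 → HasDerivAt F (-riemannZeta 3 / (4 * (Real.pi : ℂ) ^ 2)) (-2)) ∧
        (0 < θ → θ < Real.pi →
          ∃ d : ℝ, 0 < d ∧
            (d : ℂ) = 1 / (4 * (Real.pi : ℂ) * (Real.sin θ : ℂ)) *
              (HurwitzZeta.hurwitzZeta ((θ / (2 * Real.pi) : ℝ) : UnitAddCircle) 2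
                - (Real.pi : ℂ) ^ 2 / (2 * (Real.sin (θ / 2) : ℂ) ^ 2)) ∧
            HasDerivAt F (d : ℂ) (-2)) ∧
        (θ = Real.pi → HasDerivAt F (7 * riemannZeta 3 / (4 * (Real.pi : ℂ) ^ 2)) (-2)) ∧
        (θ = 0 → HasRegularValueAt F (-1 / 12) (-1)) ∧
        (0 < θ → θ < Real.pi →
          HasRegularValueAt F (1 / (4 * (Real.sin (θ / 2) : ℂ) ^ 2)) (-1)) ∧
        (θ = Real.pi → HasRegularValueAt F (1 / 4) (-1)) := by
  -- The continuation must be fixed before θ is given, so the angle is recovered from g; any θ in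
  -- [0, π] with g conjugate to `diagSU2 θ` equals it.
  refine ⟨sinRatioLSeries (Real.arccos (SU2.halfTrace g)),
    ⟨meromorphicNFOn_sinRatioLSeries _, fun s hs => ?_⟩, fun m hm he => ⟨?_, ?_⟩, ?_⟩
  · exact (wittenL_eq (Real.arccos_nonneg _) (Real.arccos_le_pi _) (SU2.isConj_diagSU2 g) hs).symm
  · refine analyticAt_sinRatioLSeries _ fun h => ?_
    have := congrArg Complex.re h
    simp at this
    have hm : (0 : ℝ) ≤ m := m.cast_nonneg
    linarith
  · exact sinRatioLSeries_neg_even _ hm he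
  · intro θ h0 h1 hg
    rw [SU2.eq_arccos_halfTrace h0 h1 hg]
    have ha : AnalyticAt ℂ (sinRatioLSeries θ) (-1) := analyticAt_sinRatioLSeries θ (by norm_num)
    refine ⟨fun s hs => ⟨(hasSum_wittenTerm h0 h1 hg hs).summable, ?_⟩,
      ⟨analyticAt_sinRatioLSeries θ (by norm_num), analyticOrderAt_sinRatioLSeries_neg_two h0 h1⟩,
      ?_, hasDerivAt_sinRatioLSeries_of_mem_Ioo, ?_, ?_,
      fun h0 h1 => ⟨ha, sinRatioLSeries_neg_one_of_mem_Ioo h0 h1⟩, ?_⟩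
    · rw [wittenL_eq h0 h1 hg hs]
      exact hasSum_sinRatioLSeries h0 h1 hs
    · rintro rfl
      exact hasDerivAt_sinRatioLSeries_zero
    · rintro rfl
      exact hasDerivAt_sinRatioLSeries_pi
    · rintro rfl
      exact ⟨ha, sinRatioLSeries_zero_neg_one⟩
    · rintro rfl
      exact ⟨ha, sinRatioLSeries_pi_neg_one⟩
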